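/- Let $N_4$ be the group of $4\times 4$ integer matrices $$g=\begin{pmatrix}1&0&0&0\\ e&1&0&0\\ a&f&1&0\\ c&b&d&1\end{pmatrix},$$ acting on $\mathbb Z^3$, by automorphisms of the lexicographic order, through $$g\cdot(i,j,k)=\bigl(i+e,\;j+d,\;k+c+bi-(a+fi)(j+d)\bigr).$$ For real $\alpha$, let $\mathrm{Diff}_+^{1+\alpha}([0,1])$ be the group of orientation-preserving $C^1$ diffeomorphisms $h$ of $[0,1]$ such that, for $h$ and for $h^{-1}$, the derivative is $\alpha$-Hölder: $|h'(x)-h'(y)|\le C|x-y|^\alpha$ for some constant $C$ and all $x,y$ (for $\alpha\le 0$ this is no further condition). A *Pixton–Tsuboi family* assigns to any two pairs of contiguous bounded intervals $(I',I)$ and $(J',J)$ ($I'$ adjacent to $I$ on the left, $J'$ adjacent to $J$ on the left) a $C^\infty$ diffeomorphism $\varphi_{I',I}^{J',J}\colon \bar I\to \bar J$ such that: $\varphi_{J',J}^{K',K}\circ\varphi_{I',I}^{J',J}=\varphi_{I',I}^{K',K}$; the derivative of $\varphi_{I',I}^{J',J}$ is $|J'|/|I'|$ at the left and $|J|/|I|$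 at the right endpoint of $I$; and there is a constant $M$ with $$\bigl|D\log D\varphi_{I',I}^{J',J}(x)\bigr|\le \frac{M}{|I|}\left|\frac{|I|}{|J|}\,\frac{|J'|}{|I'|}-1\right|\qquad(x\in \bar I)$$ whenever $\max\{|I'|,|I|,|J'|,|J|\}\le 2\min\{|I'|,|I|,|J'|,|J|\}$. **Theorem A.** For every $\alpha<1/2$ the group $N_4$ embeds into $\mathrm{Diff}_+^{1+\alpha}([0,1])$. More precisely, there are an injective homomorphism $\rho\colon N_4\to \mathrm{Diff}_+^{1+\alpha}([0,1])$, real numbers $p,q,r>0$ with (i) $\alpha+r\le 2$; (ii) $4r\le p$; (iii) $4r\le q$; (iv) $4\le p(1-\alpha)$; (v) $4\le q(1-\alpha)$; (vi) $\frac1p+\frac1q+\frac1r<1$; (vii) $\alpha\le\frac1p+\frac1r$ and $\alpha\le\frac{r}{p(r-1)}$; (viii) $\alpha\le\frac1q+\frac1r$ and $\alpha\le\frac{r}{q(r-1)}$, a family of disjoint open intervals $(I_{i,j,k})_{(i,j,k)\in\mathbb Z^3}$ in $[0,1]$ with dense union, placed from left to right in the lexicographic order of $\mathbb Z^3$, of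 lengths $$|I_{i,j,k}|=\frac1L\cdot\frac{1}{|i|^p+|j|^q+|k|^r+1},\qquad L=\sum_{(i,j,k)\in\mathbb Z^3}\frac{1}{|i|^p+|j|^q+|k|^r+1}<\infty,$$ and a Pixton–Tsuboi family $\varphi$, such that for all $g\in N_4$ and $(i,j,k)\in\mathbb Z^3$, writing $(i',j',k')=g\cdot(i,j,k)$, the map $\rho(g)$ coincides on $\overline{I_{i,j,k}}$ with $$\varphi_{I_{i,j,k-1},\,I_{i,j,k}}^{I_{i',j',k'-1},\,I_{i',j',k'}}.$$ -/

import Mathlib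

open scoped ContDiff

noncomputable section

/-! ### The group of unipotent lower triangular integer matrices -/

/-- The group `N₄` of lower triangular `4 × 4` integer matrices with `1` on the diagonal. Such
matrices have determinant `1`, so it is realized as a subgroup of `SL(4, ℤ)`. -/
def N4 : Subgroup (Matrix.SpecialLinearGroup (Fin 4) ℤ) where
  carrier := {M | (∀ i, M i i = 1) ∧ ∀ i j, i < j → M i j = 0}
  one_mem' := by
    refine ⟨fun i => by simp, fun i j h => ?_⟩
    simp [h.ne]
  mul_mem' := by
    rintro A B ⟨hA, hA'⟩ ⟨hB, hB'⟩
    refine ⟨fun i => ?_, fun i j hij => ?_⟩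
    · rw [Matrix.SpecialLinearGroup.coe_mul, Matrix.mul_apply, Finset.sum_eq_single i]
      · rw [hA, hB, one_mul]
      · intro k _ hk
        rcases lt_or_gt_of_ne hk with h | h
        · rw [hB' k i h, mul_zero]
        · rw [hA' i k h, zero_mul]
      · simp
    · rw [Matrix.SpecialLinearGroup.coe_mul, Matrix.mul_apply]
      refine Finset.sum_eq_zero fun k _ => ?_
      rcases lt_or_ge i k with h | h
      · rw [hA' i k h, zero_mul]
      · rw [hB' k j (lt_of_le_of_lt h hij), mul_zero]
  inv_mem' := by
    rintro A ⟨hA, hA'⟩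
    have h : ∀ i j, (∑ k, A i k * (A⁻¹) k j) = (1 : Matrix (Fin 4) (Fin 4) ℤ) i j := by
      intro i j
      rw [← Matrix.mul_apply, ← Matrix.SpecialLinearGroup.coe_mul, mul_inv_cancel,
        Matrix.SpecialLinearGroup.coe_one]
    have e01 := hA' 0 1 (by decide)
    have e02 := hA' 0 2 (by decide)
    have e03 := hA' 0 3 (by decide)
    have e12 := hA' 1 2 (by decide)
    have e13 := hA' 1 3 (by decide)
    have e23 := hA' 2 3 (by decide)
    simp only [Fin.sum_univ_four] at h
    have r0 : ∀ j, (A⁻¹) 0 j = (1 : Matrix (Fin 4) (Fin 4) ℤ) 0 j := by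
      intro j; have := h 0 j; rw [hA, e01, e02, e03] at this; linarith
    have r1 : ∀ j, A 1 0 * (A⁻¹) 0 j + (A⁻¹) 1 j = (1 : Matrix (Fin 4) (Fin 4) ℤ) 1 j := by
      intro j; have := h 1 j; rw [hA, e12, e13] at this; linarith
    have r2 : ∀ j, A 2 0 * (A⁻¹) 0 j + A 2 1 * (A⁻¹) 1 j + (A⁻¹) 2 j
        = (1 : Matrix (Fin 4) (Fin 4) ℤ) 2 j := by
      intro j; have := h 2 j; rw [hA, e23] at this; linarith
    have r3 : ∀ j, A 3 0 * (A⁻¹) 0 j + A 3 1 * (A⁻¹) 1 j + A 3 2 * (A⁻¹) 2 j + (A⁻¹) 3 j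
        = (1 : Matrix (Fin 4) (Fin 4) ℤ) 3 j := by
      intro j; have := h 3 j; rw [hA] at this; linarith
    have z01 : (A⁻¹) 0 1 = 0 := by simpa using r0 1
    have z02 : (A⁻¹) 0 2 = 0 := by simpa using r0 2
    have z03 : (A⁻¹) 0 3 = 0 := by simpa using r0 3
    have z12 : (A⁻¹) 1 2 = 0 := by simpa [z02] using r1 2
    have z13 : (A⁻¹) 1 3 = 0 := by simpa [z03] using r1 3
    have z23 : (A⁻¹) 2 3 = 0 := by simpa [z03, z13] using r2 3
    have d0 : (A⁻¹) 0 0 = 1 := by simpa using r0 0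
    have d1 : (A⁻¹) 1 1 = 1 := by simpa [z01] using r1 1
    have d2 : (A⁻¹) 2 2 = 1 := by simpa [z02, z12] using r2 2
    have d3 : (A⁻¹) 3 3 = 1 := by simpa [z03, z13, z23] using r3 3
    clear r0 r1 r2 r3 h
    generalize A⁻¹ = B at *
    change (∀ i, B i i = 1) ∧ ∀ i j, i < j → B i j = 0
    refine ⟨Fin.forall_fin_succ.2 ⟨d0, Fin.forall_fin_succ.2 ⟨d1, Fin.forall_fin_two.2 ⟨d2, d3⟩⟩⟩,
      fun i j hij => ?_⟩
    have hc : (i = 0 ∧ j = 1) ∨ (i = 0 ∧ j = 2) ∨ (i = 0 ∧ j = 3) ∨ (i = 1 ∧ j = 2) ∨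
        (i = 1 ∧ j = 3) ∨ (i = 2 ∧ j = 3) := by
      clear z01 z02 z03 z12 z13 z23
      revert i j; decide
    rcases hc with ⟨rfl, rfl⟩ | ⟨rfl, rfl⟩ | ⟨rfl, rfl⟩ | ⟨rfl, rfl⟩ | ⟨rfl, rfl⟩ | ⟨rfl, rfl⟩
    exacts [z01, z02, z03, z12, z13, z23]

/-! ### The action on `ℤ³` with its lexicographic order -/

/-- `ℤ³` with the lexicographic order. -/
abbrev LexZ3 : Type := ℤ ×ₗ ℤ ×ₗ ℤ

namespace LexZ3

/-- The triple `(i, j, k)` as an element of `LexZ3`. -/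
def mk (i j k : ℤ) : LexZ3 := toLex (i, toLex (j, k))

/-- First coordinate. -/
def fstCoord (v : LexZ3) : ℤ := (ofLex v).1

/-- Second coordinate. -/
def sndCoord (v : LexZ3) : ℤ := (ofLex (ofLex v).2).1

/-- Third coordinate. -/
def trdCoord (v : LexZ3) : ℤ := (ofLex (ofLex v).2).2

/-- `(i, j, k) ↦ (i, j, k + n)`. -/
def shift (n : ℤ) (v : LexZ3) : LexZ3 := mk v.fstCoord v.sndCoord (v.trdCoord + n)

theorem lt_iff (v w : LexZ3) : v < w ↔ v.fstCoord < w.fstCoord ∨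
    v.fstCoord = w.fstCoord ∧ (v.sndCoord < w.sndCoord ∨
      v.sndCoord = w.sndCoord ∧ v.trdCoord < w.trdCoord) := by
  rw [Prod.Lex.lt_iff, Prod.Lex.lt_iff]
  rfl

theorem shift_lt_shift (v : LexZ3) {m n : ℤ} (h : m < n) : v.shift m < v.shift n :=
  (lt_iff _ _).2 (Or.inr ⟨rfl, Or.inr ⟨rfl, (add_lt_add_iff_left _).2 h⟩⟩)

/-- The transformation of `ℤ³` given by the matrix with rows
`(1,0,0,0), (e,1,0,0), (a,f,1,0), (c,b,d,1)`, namely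
`(i, j, k) ↦ (i + e, j + d, k + c + b i - (a + f i) (j + d))`.

For the elementary generators this reads
`e : (i+1, j, k)`, `d : (i, j+1, k)`, `f : (i, j, k - ij)`, `a : (i, j, k - j)`,
`b : (i, j, k + i)`, `c : (i, j, k + 1)`. -/
def act (g : N4) (v : LexZ3) : LexZ3 :=
  mk (v.fstCoord + g.1 1 0) (v.sndCoord + g.1 3 2)
    (v.trdCoord + g.1 3 0 + g.1 3 1 * v.fstCoord
      - (g.1 2 0 + g.1 2 1 * v.fstCoord) * (v.sndCoord + g.1 3 2))

theorem act_one (v : LexZ3) : act 1 v = v := by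
  have h : ∀ i j : Fin 4, i ≠ j → (1 : Matrix (Fin 4) (Fin 4) ℤ) i j = 0 :=
    fun i j hij => Matrix.one_apply_ne hij
  simp only [act, OneMemClass.coe_one, Matrix.SpecialLinearGroup.coe_one]
  rw [h 1 0 (by decide), h 3 2 (by decide), h 3 0 (by decide), h 3 1 (by decide),
    h 2 0 (by decide), h 2 1 (by decide)]
  simp only [add_zero, zero_mul, sub_zero]
  rfl

theorem act_mul (g h : N4) (v : LexZ3) : act (g * h) v = act g (act h v) := by
  obtain ⟨A, hA, hA'⟩ := g
  obtain ⟨B, hB, hB'⟩ := h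
  have key : ∀ i j, (A * B) i j = A i 0 * B 0 j + A i 1 * B 1 j + A i 2 * B 2 j
      + A i 3 * B 3 j := by
    intro i j
    rw [Matrix.SpecialLinearGroup.coe_mul, Matrix.mul_apply, Fin.sum_univ_four]
  have a01 := hA' 0 1 (by decide)
  have a02 := hA' 0 2 (by decide)
  have a03 := hA' 0 3 (by decide)
  have a12 := hA' 1 2 (by decide)
  have a13 := hA' 1 3 (by decide)
  have a23 := hA' 2 3 (by decide)
  have b01 := hB' 0 1 (by decide)
  have b02 := hB' 0 2 (by decide)
  have b03 := hB' 0 3 (by decide)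
  have b12 := hB' 1 2 (by decide)
  have b13 := hB' 1 3 (by decide)
  have b23 := hB' 2 3 (by decide)
  have ext3 : ∀ {i j k i' j' k' : ℤ}, i = i' → j = j' → k = k' → mk i j k = mk i' j' k' := by
    rintro _ _ _ _ _ _ rfl rfl rfl; rfl
  unfold act
  apply ext3
  · simp only [Subgroup.coe_mul, key, hA, hB, a12, a13]
    simp only [fstCoord, mk, ofLex_toLex]
    ring
  · simp only [Subgroup.coe_mul, key, hA, hB, b02, b12]
    simp only [sndCoord, mk, ofLex_toLex]
    ring
  · simp only [Subgroup.coe_mul, key, hA, hB, a23, b01, b02, b12]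
    simp only [fstCoord, sndCoord, trdCoord, mk, ofLex_toLex]
    ring

theorem act_strictMono (g : N4) : StrictMono (act g) := by
  intro v w h
  rw [lt_iff] at h ⊢
  simp only [act, mk, fstCoord, sndCoord, trdCoord, ofLex_toLex] at h ⊢
  rcases h with h | ⟨h, h' | ⟨h', h''⟩⟩
  · left; linarith
  · right; exact ⟨by rw [h], Or.inl (by linarith)⟩
  · right; refine ⟨by rw [h], Or.inr ⟨by rw [h'], ?_⟩⟩
    rw [h, h']; linarith

end LexZ3

/-- The action of `N₄` on `ℤ³` by automorphisms of the lexicographic order. -/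
def latticeAction : N4 →* (LexZ3 ≃o LexZ3) where
  toFun g :=
    { toFun := LexZ3.act g
      invFun := LexZ3.act g⁻¹
      left_inv := fun v => by rw [← LexZ3.act_mul, inv_mul_cancel, LexZ3.act_one]
      right_inv := fun v => by rw [← LexZ3.act_mul, mul_inv_cancel, LexZ3.act_one]
      map_rel_iff' := (LexZ3.act_strictMono g).le_iff_le }
  map_one' := by ext v; exact LexZ3.act_one v
  map_mul' g h := by ext v; exact LexZ3.act_mul g h v

/-! ### Diffeomorphisms of class `C^{1+α}` of the closed unit interval -/

/-- A self-map of `[0,1]` as a real function (constant outside of `[0,1]`). -/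
def unitExtend (f : unitInterval → unitInterval) : ℝ → ℝ :=
  Set.IccExtend (zero_le_one' ℝ) fun x => (f x : ℝ)

/-- `f` is `C¹` on `[0,1]` (one-sided at the endpoints) and
`|f'(x) - f'(y)| ≤ C |x - y| ^ α` for some constant `C`. (For `α ≤ 0` the second condition
follows from the first one.) -/
def IsC1Holder (α : ℝ) (f : unitInterval → unitInterval) : Prop :=
  ContDiffOn ℝ 1 (unitExtend f) (Set.Icc 0 1) ∧
    ∃ C : ℝ, ∀ x ∈ Set.Icc (0 : ℝ) 1, ∀ y ∈ Set.Icc (0 : ℝ) 1,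
      |derivWithin (unitExtend f) (Set.Icc 0 1) x - derivWithin (unitExtend f) (Set.Icc 0 1) y|
        ≤ C * |x - y| ^ α

theorem unitExtend_mem (f : unitInterval → unitInterval) (x : ℝ) :
    unitExtend f x ∈ Set.Icc (0 : ℝ) 1 := (f _).2

theorem unitExtend_comp (f g : unitInterval → unitInterval) :
    unitExtend (f ∘ g) = unitExtend f ∘ unitExtend g := by
  ext x
  simp [unitExtend, Set.IccExtend, Set.projIcc_val]

theorem isC1Holder_id (α : ℝ) : IsC1Holder α id := by
  have h : Set.EqOn (unitExtend id) id (Set.Icc 0 1) := fun x hx => by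
    simp [unitExtend, Set.IccExtend_of_mem _ _ hx]
  refine ⟨contDiffOn_id.congr h, 0, fun x hx y hy => ?_⟩
  rw [derivWithin_congr h (h hx), derivWithin_congr h (h hy),
    derivWithin_id _ _ (uniqueDiffOn_Icc zero_lt_one x hx),
    derivWithin_id _ _ (uniqueDiffOn_Icc zero_lt_one y hy)]
  simp

theorem IsC1Holder.comp {α : ℝ} {f g : unitInterval → unitInterval}
    (hf : IsC1Holder α f) (hg : IsC1Holder α g) : IsC1Holder α (f ∘ g) := by
  obtain ⟨hf1, C, hC⟩ := hf
  obtain ⟨hg1, D, hD⟩ := hg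
  set s : Set ℝ := Set.Icc 0 1 with hs
  have hu : UniqueDiffOn ℝ s := uniqueDiffOn_Icc zero_lt_one
  set F := unitExtend f
  set G := unitExtend g
  have hGs : Set.MapsTo G s s := fun x _ => unitExtend_mem g x
  have hcd : ContDiffOn ℝ 1 (F ∘ G) s := hf1.comp hg1 hGs
  rw [IsC1Holder, unitExtend_comp]
  refine ⟨hcd, ?_⟩
  have hFc : ContinuousOn (derivWithin F s) s := hf1.continuousOn_derivWithin hu le_rfl
  have hGc : ContinuousOn (derivWithin G s) s := hg1.continuousOn_derivWithin hu le_rfl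
  obtain ⟨A, hA⟩ := isCompact_Icc.exists_bound_of_continuousOn hFc
  obtain ⟨B, hB⟩ := isCompact_Icc.exists_bound_of_continuousOn hGc
  simp only [Real.norm_eq_abs] at hA hB
  have h0 : (0 : ℝ) ∈ s := ⟨le_rfl, zero_le_one⟩
  have hA0 : 0 ≤ A := (abs_nonneg _).trans (hA 0 h0)
  have hB0 : 0 ≤ B := (abs_nonneg _).trans (hB 0 h0)
  have hchain : ∀ x ∈ s, derivWithin (F ∘ G) s x
      = derivWithin F s (G x) * derivWithin G s x := fun x hx =>
    derivWithin_comp x (hf1.differentiableOn one_ne_zero _ (hGs hx))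
      (hg1.differentiableOn one_ne_zero _ hx) hGs
  rcases lt_or_ge α 0 with hα | hα
  · refine ⟨2 * (A * B), fun x hx y hy => ?_⟩
    rcases eq_or_ne x y with rfl | hxy
    · rw [sub_self, abs_zero]; positivity
    have hbd : ∀ z ∈ s, |derivWithin (F ∘ G) s z| ≤ A * B := fun z hz => by
      rw [hchain z hz, abs_mul]
      exact mul_le_mul (hA _ (hGs hz)) (hB _ hz) (abs_nonneg _) hA0
    have h1 : 1 ≤ |x - y| ^ α := by
      apply Real.one_le_rpow_of_pos_of_le_one_of_nonpos (abs_pos.2 (sub_ne_zero.2 hxy)) _ hα.le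
      rw [abs_le]; constructor <;> linarith [hx.1, hx.2, hy.1, hy.2]
    calc _ ≤ |derivWithin (F ∘ G) s x| + |derivWithin (F ∘ G) s y| := abs_sub _ _
      _ ≤ 2 * (A * B) := by linarith [hbd x hx, hbd y hy]
      _ ≤ 2 * (A * B) * |x - y| ^ α := le_mul_of_one_le_right (by positivity) h1
  · refine ⟨|C| * B ^ α * B + A * |D|, fun x hx y hy => ?_⟩
    have hlip : |G x - G y| ≤ B * |x - y| := by
      have := (convex_Icc (0 : ℝ) 1).norm_image_sub_le_of_norm_derivWithin_le
        (hg1.differentiableOn one_ne_zero) (fun z hz => by simpa using hB z hz) hy hx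
      simpa using this
    have hpow : |G x - G y| ^ α ≤ B ^ α * |x - y| ^ α := by
      rw [← Real.mul_rpow hB0 (abs_nonneg _)]
      exact Real.rpow_le_rpow (abs_nonneg _) hlip hα
    have e1 : |derivWithin F s (G x) - derivWithin F s (G y)| ≤ |C| * (B ^ α * |x - y| ^ α) :=
      (hC _ (hGs hx) _ (hGs hy)).trans (mul_le_mul (le_abs_self C) hpow
        (Real.rpow_nonneg (abs_nonneg _) _) (abs_nonneg _))
    have e2 : |derivWithin G s x - derivWithin G s y| ≤ |D| * |x - y| ^ α :=
      (hD _ hx _ hy).trans (mul_le_mul_of_nonneg_right (le_abs_self D)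
        (Real.rpow_nonneg (abs_nonneg _) _))
    rw [hchain x hx, hchain y hy]
    calc _ = |(derivWithin F s (G x) - derivWithin F s (G y)) * derivWithin G s x
          + derivWithin F s (G y) * (derivWithin G s x - derivWithin G s y)| := by
          congr 1; ring
      _ ≤ |derivWithin F s (G x) - derivWithin F s (G y)| * |derivWithin G s x|
          + |derivWithin F s (G y)| * |derivWithin G s x - derivWithin G s y| := by
          rw [← abs_mul, ← abs_mul]; exact abs_add_le _ _
      _ ≤ |C| * (B ^ α * |x - y| ^ α) * B + A * (|D| * |x - y| ^ α) :=
          add_le_add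
            (mul_le_mul e1 (hB x hx) (abs_nonneg _) ((abs_nonneg _).trans e1))
            (mul_le_mul (hA _ (hGs hy)) e2 (abs_nonneg _) hA0)
      _ = _ := by ring

/-- The group `Diff₊^{1+α}([0,1])`: the increasing homeomorphisms `f` of `[0,1]` such that `f` and
its inverse are of class `C^{1+α}`. The product is composition. -/
def DiffPlus (α : ℝ) : Subgroup (unitInterval ≃ₜ unitInterval) where
  carrier := {f | StrictMono f ∧ IsC1Holder α f ∧ IsC1Holder α f.symm}
  one_mem' := ⟨strictMono_id, isC1Holder_id α, isC1Holder_id α⟩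
  mul_mem' := fun {f g} hf hg =>
    ⟨hf.1.comp hg.1, hf.2.1.comp hg.2.1, hg.2.2.comp hf.2.2⟩
  inv_mem' := fun {f} hf => by
    refine ⟨fun x y hxy => ?_, hf.2.2, hf.2.1⟩
    have : f (f.symm x) < f (f.symm y) := by simpa using hxy
    exact hf.1.lt_iff_lt.1 this

/-! ### Pixton–Tsuboi maps -/

/-- A pair of contiguous bounded intervals `I' = (a, b)` and `I = (b, c)`, with `I'` on the left
of `I`. -/
structure ContigPair where
  /-- left endpoint of `I'` -/
  a : ℝ
  /-- common endpoint -/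
  b : ℝ
  /-- right endpoint of `I` -/
  c : ℝ
  hab : a < b
  hbc : b < c

namespace ContigPair

/-- The closed interval `[b, c]`, the closure of `I`. -/
def main (P : ContigPair) : Set ℝ := Set.Icc P.b P.c

/-- The length of `I'`. -/
def lenLeft (P : ContigPair) : ℝ := P.b - P.a

/-- The length of `I`. -/
def len (P : ContigPair) : ℝ := P.c - P.b

end ContigPair

/-- A Pixton–Tsuboi family: for any two pairs `P = (I', I)` and `Q = (J', J)` of contiguous
intervals, a `C^∞` diffeomorphism `φ P Q` from (the closure of) `I` to (that of) `J`, such that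
the equivariance relation, the formulas for the derivatives at the endpoints and the estimate of
`D log Dφ` hold. (By bijectivity and equivariance `φ P P` is the identity, so `φ Q P` is the
inverse of `φ P Q`; hence smoothness of the inverses is included in `smooth`.) -/
structure IsPixtonTsuboi (φ : ContigPair → ContigPair → ℝ → ℝ) : Prop where
  bijOn : ∀ P Q, Set.BijOn (φ P Q) P.main Q.main
  smooth : ∀ P Q, ContDiffOn ℝ ∞ (φ P Q) P.main
  equivariance : ∀ P Q R, ∀ x ∈ P.main, φ Q R (φ P Q x) = φ P R x
  deriv_left : ∀ P Q, derivWithin (φ P Q) P.main P.b = Q.lenLeft / P.lenLeft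
  deriv_right : ∀ P Q, derivWithin (φ P Q) P.main P.c = Q.len / P.len
  regularity : ∃ M : ℝ, ∀ P Q : ContigPair,
    max (max P.lenLeft P.len) (max Q.lenLeft Q.len)
      ≤ 2 * min (min P.lenLeft P.len) (min Q.lenLeft Q.len) →
    ∀ x ∈ P.main,
      |derivWithin (fun y => Real.log (derivWithin (φ P Q) P.main y)) P.main x|
        ≤ M / P.len * |P.len / Q.len * (Q.lenLeft / P.lenLeft) - 1|

/-! ### The intervals `I_{i,j,k}` -/

/-- A family of disjoint open intervals `I_v ⊆ [0,1]`, `v ∈ ℤ³`, with dense union, disposed in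
the lexicographic order. Since `(i,j,k)` and `(i,j,k+1)` are consecutive, density forces
`I_{i,j,k}` and `I_{i,j,k+1}` to share an endpoint; so the family is given by the left endpoints,
and `I_{i,j,k} = (left (i,j,k), left (i,j,k+1))`. -/
structure LexIntervals where
  /-- the left endpoint of `I_v` -/
  left : LexZ3 → ℝ
  strictMono : StrictMono left
  mem : ∀ v, left v ∈ Set.Icc (0 : ℝ) 1
  dense : Set.Icc (0 : ℝ) 1 ⊆ closure (⋃ v, Set.Ioo (left v) (left (v.shift 1)))

namespace LexIntervals

/-- The contiguous pair `(I_{i,j,k-1}, I_{i,j,k})`. -/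
def pair (S : LexIntervals) (v : LexZ3) : ContigPair where
  a := S.left (v.shift (-1))
  b := S.left (v.shift 0)
  c := S.left (v.shift 1)
  hab := S.strictMono (v.shift_lt_shift (by norm_num))
  hbc := S.strictMono (v.shift_lt_shift (by norm_num))

end LexIntervals

/-- The weight `1 / (|i|^p + |j|^q + |k|^r + 1)`. -/
def lexWeight (p q r : ℝ) (v : LexZ3) : ℝ :=
  1 / (|(v.fstCoord : ℝ)| ^ p + |(v.sndCoord : ℝ)| ^ q + |(v.trdCoord : ℝ)| ^ r + 1)

/-- The length of `I_{i,j,k}` is `1 / (|i|^p + |j|^q + |k|^r + 1)`, after the renormalization that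
gives total length `1`. -/
def LexIntervals.HasLengths (S : LexIntervals) (p q r : ℝ) : Prop :=
  Summable (lexWeight p q r) ∧
    ∀ v, (S.pair v).len = lexWeight p q r v / ∑' w, lexWeight p q r w

/-- The conditions relating the regularity `α` and the exponents `p, q, r > 0`. -/
structure AdmissibleExponents (α p q r : ℝ) : Prop where
  p_pos : 0 < p
  q_pos : 0 < q
  r_pos : 0 < r
  cond_i : α + r ≤ 2
  cond_ii : 4 * r ≤ p
  cond_iii : 4 * r ≤ q
  cond_iv : 4 ≤ p * (1 - α)
  cond_v : 4 ≤ q * (1 - α)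
  cond_vi : 1 / p + 1 / q + 1 / r < 1
  cond_vii : α ≤ 1 / p + 1 / r ∧ α ≤ r / (p * (r - 1))
  cond_viii : α ≤ 1 / q + 1 / r ∧ α ≤ r / (q * (r - 1))

end

/-! On each interval `I_v` the diffeomorphism attached to `g` must be the Pixton–Tsuboi map onto
`I_{gv}`, so its derivative there is prescribed (`cellDeriv`). The prescribed slopes at endpoints
make these pieces agree where two intervals of a line `(i, j, *)` meet, and at both ends of a line
the derivative tends to `1`, because `|I_{gv}| / |I_v| → 1`. The core is to show that this function
is `α`-Hölder; its primitive `cellMap` is then the diffeomorphism, and the group law follows from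
equivariance on a dense set.

Take `p = q = 8`, `4/3 < r ≤ 3/2`, and write `D` for `denom`. The central estimate `denom_cross_sub`
says that the quotient of two consecutive lengths changes under `g` by `O(D ^ (-(1/8 + 1/r)))`. By
`abs_dmap_sub_le` this quantity times `|x - y| / |I_v|` bounds the oscillation of the derivative on
`I_v`, so the derivative is `α`-Hölder there with a constant `b v` of order `D ^ (-(1/8 + 1/r -
α))`.

Along a line, Hölder's inequality with exponents `1/(1-α)` and `1/α` reduces the estimate to a bound
for `∑ b ^ (1/(1-α))`, which holds as soon as `α (r - 1) < r/8`; points on different lines are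
compared through the value `1` (`CellwiseHolder.holder`, `exists_cellwiseHolder`). Summability of
the lengths asks for `r > 4/3`, and at `r = 4/3` the condition reads `α < 1/2`. Hence for every `α <
1/2` some `r` slightly above `4/3` works. -/

noncomputable section

/-! ### A Pixton–Tsuboi family -/

namespace PixtonTsuboi

/-- The denominator of `chart`. -/
def den (s z : ℝ) : ℝ := 1 + (s - 1) * (z * (1 - z))

/-- The numerator of the derivative of `chart`. -/
def num (s z : ℝ) : ℝ := 1 + (s - 1) * z ^ 2

/-- A diffeomorphism of `[0,1]` with derivative `1` at `0` and `s` at `1`. -/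
def chart (s z : ℝ) : ℝ := z / den s z

/-- The discriminant appearing in the inverse of `chart`. -/
def disc (s y : ℝ) : ℝ := (1 - (s - 1) * y) ^ 2 + 4 * (s - 1) * y ^ 2

/-- The inverse of `chart` on `[0,1]`. -/
def chartInv (s y : ℝ) : ℝ := 2 * y / (1 - (s - 1) * y + √(disc s y))

variable {s t z y κ : ℝ}

/-- Both `num s z` and `den s z` are convex combinations of `1` and `s`, with weight `z ^ 2`,
respectively `z * (1 - z)`, on `s`; common bounds for `1` and `s` therefore pass to them. -/
theorem num_mem (h0 : κ ≤ 1) (hs : κ ≤ s) (hz : z ∈ Set.Icc (0 : ℝ) 1) : κ ≤ num s z := by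
  have h1 : z ^ 2 ≤ 1 := by nlinarith [hz.1, hz.2]
  unfold num
  nlinarith [sq_nonneg z, mul_nonneg (sub_nonneg.2 hs) (sq_nonneg z),
    mul_nonneg (sub_nonneg.2 h0) (sub_nonneg.2 h1)]

theorem den_mem (h0 : κ ≤ 1) (hs : κ ≤ s) (hz : z ∈ Set.Icc (0 : ℝ) 1) : κ ≤ den s z := by
  have h2 : 0 ≤ z * (1 - z) := mul_nonneg hz.1 (sub_nonneg.2 hz.2)
  have h1 : z * (1 - z) ≤ 1 := by nlinarith [hz.1, hz.2]
  unfold den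
  nlinarith [mul_nonneg (sub_nonneg.2 hs) h2,
    mul_nonneg (sub_nonneg.2 h0) (sub_nonneg.2 h1)]

theorem den_le (hs : s ≤ κ) (h1 : 1 ≤ κ) (hz : z ∈ Set.Icc (0 : ℝ) 1) : den s z ≤ κ := by
  have h2 : 0 ≤ z * (1 - z) := mul_nonneg hz.1 (sub_nonneg.2 hz.2)
  have h1 : z * (1 - z) ≤ 1 := by nlinarith [hz.1, hz.2]
  unfold den
  nlinarith [mul_nonneg (sub_nonneg.2 hs) h2]

theorem num_le (hs : s ≤ κ) (h1 : 1 ≤ κ) (hz : z ∈ Set.Icc (0 : ℝ) 1) : num s z ≤ κ := by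
  have h1 : z ^ 2 ≤ 1 := by nlinarith [hz.1, hz.2]
  unfold num
  nlinarith [mul_nonneg (sub_nonneg.2 hs) (sq_nonneg z)]

theorem num_pos (hs : 0 < s) (hz : z ∈ Set.Icc (0 : ℝ) 1) : 0 < num s z :=
  lt_of_lt_of_le (lt_min one_pos hs) (num_mem (min_le_left _ _) (min_le_right _ _) hz)

theorem den_pos (hs : 0 < s) (hz : z ∈ Set.Icc (0 : ℝ) 1) : 0 < den s z :=
  lt_of_lt_of_le (lt_min one_pos hs) (den_mem (min_le_left _ _) (min_le_right _ _) hz)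

theorem hasDerivAt_num (s z : ℝ) : HasDerivAt (num s) ((s - 1) * (2 * z)) z := by
  have h := ((hasDerivAt_pow 2 z).const_mul (s - 1)).const_add 1
  exact h.congr_deriv (by simp)

theorem hasDerivAt_den (s z : ℝ) : HasDerivAt (den s) ((s - 1) * (1 - 2 * z)) z := by
  have h := (((hasDerivAt_id z).mul ((hasDerivAt_id z).const_sub 1)).const_mul
    (s - 1)).const_add 1
  exact h.congr_deriv (by simp only [id]; ring)

theorem hasDerivAt_chart (hs : 0 < s) (hz : z ∈ Set.Icc (0 : ℝ) 1) :
    HasDerivAt (chart s) (num s z / den s z ^ 2) z := by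
  have h := (hasDerivAt_id z).div (hasDerivAt_den s z) (den_pos hs hz).ne'
  exact h.congr_deriv (by simp only [id, num, den]; ring)

theorem chart_zero (s : ℝ) : chart s 0 = 0 := by simp [chart]

theorem chart_one (s : ℝ) : chart s 1 = 1 := by simp [chart, den]

theorem chart_mem (hs : 0 < s) (hz : z ∈ Set.Icc (0 : ℝ) 1) : chart s z ∈ Set.Icc (0 : ℝ) 1 := by
  have h := den_pos hs hz
  refine ⟨div_nonneg hz.1 h.le, (div_le_one h).2 ?_⟩
  unfold den
  nlinarith [mul_nonneg hs.le (mul_nonneg hz.1 (sub_nonneg.2 hz.2)), hz.1, hz.2,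
    mul_nonneg (sub_nonneg.2 hz.2) (sub_nonneg.2 hz.2)]

theorem continuousOn_chart (hs : 0 < s) : ContinuousOn (chart s) (Set.Icc 0 1) := fun _ hz =>
  (hasDerivAt_chart hs hz).continuousAt.continuousWithinAt

theorem chart_surjOn (hs : 0 < s) : Set.SurjOn (chart s) (Set.Icc 0 1) (Set.Icc 0 1) := by
  have h := intermediate_value_Icc (zero_le_one' ℝ) (continuousOn_chart hs)
  rwa [chart_zero, chart_one] at h

/-- The equation `chart s z = y` is the quadratic `(s - 1) y z² + (1 - (s - 1) y) z - y = 0`, with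
discriminant `disc s y`. Its derivative in `z` at the root is `num / den > 0`, which selects the
positive square root. Writing the root with the radical in the denominator makes `chartInv`
meaningful for `s = 1` too. -/
theorem disc_chart (hs : 0 < s) (hz : z ∈ Set.Icc (0 : ℝ) 1) :
    √(disc s (chart s z)) = num s z / den s z := by
  have h := den_pos hs hz
  have : disc s (chart s z) = (num s z / den s z) ^ 2 := by
    unfold disc chart
    field_simp
    unfold num den
    ring
  rw [this, Real.sqrt_sq (div_nonneg (num_pos hs hz).le h.le)]

theorem chartInv_den_chart (hs : 0 < s) (hz : z ∈ Set.Icc (0 : ℝ) 1) :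
    1 - (s - 1) * chart s z + √(disc s (chart s z)) = 2 / den s z := by
  have h := den_pos hs hz
  rw [disc_chart hs hz, chart]
  field_simp
  unfold num den
  ring

theorem chartInv_chart (hs : 0 < s) (hz : z ∈ Set.Icc (0 : ℝ) 1) :
    chartInv s (chart s z) = z := by
  have h := den_pos hs hz
  rw [chartInv, chartInv_den_chart hs hz, chart]
  field_simp

theorem chart_chartInv (hs : 0 < s) (hy : y ∈ Set.Icc (0 : ℝ) 1) :
    chart s (chartInv s y) = y := by
  obtain ⟨z, hz, rfl⟩ := chart_surjOn hs hy
  rw [chartInv_chart hs hz]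

theorem chartInv_mem (hs : 0 < s) (hy : y ∈ Set.Icc (0 : ℝ) 1) :
    chartInv s y ∈ Set.Icc (0 : ℝ) 1 := by
  obtain ⟨z, hz, rfl⟩ := chart_surjOn hs hy
  rwa [chartInv_chart hs hz]

theorem chartInv_zero (hs : 0 < s) : chartInv s 0 = 0 := by
  simpa [chart_zero] using chartInv_chart hs (z := 0) (by simp)

theorem chartInv_one (hs : 0 < s) : chartInv s 1 = 1 := by
  simpa [chart_one] using chartInv_chart hs (z := 1) (by simp)

theorem contDiffAt_chart (hs : 0 < s) (hz : z ∈ Set.Icc (0 : ℝ) 1) :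
    ContDiffAt ℝ ∞ (chart s) z := by
  have h := (den_pos hs hz).ne'
  unfold chart
  refine contDiffAt_id.div ?_ h
  unfold den
  fun_prop

/-- Smoothness is read off the explicit formula: at `chart s z` the radicand is `(num / den) ^ 2`
and the denominator is `2 / den`, both nonzero. -/
theorem contDiffAt_chartInv (hs : 0 < s) (hy : y ∈ Set.Icc (0 : ℝ) 1) :
    ContDiffAt ℝ ∞ (chartInv s) y := by
  obtain ⟨z, hz, rfl⟩ := chart_surjOn hs hy
  have h1 : disc s (chart s z) ≠ 0 := by
    intro h
    have h2 := disc_chart hs hz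
    rw [h, Real.sqrt_zero] at h2
    exact (div_pos (num_pos hs hz) (den_pos hs hz)).ne h2
  have h2 : 1 - (s - 1) * chart s z + √(disc s (chart s z)) ≠ 0 := by
    rw [chartInv_den_chart hs hz]
    exact (div_pos two_pos (den_pos hs hz)).ne'
  have h3 : ContDiffAt ℝ ∞ (disc s) (chart s z) := by unfold disc; fun_prop
  unfold chartInv
  refine ContDiffAt.div (by fun_prop) (ContDiffAt.add (by fun_prop) (h3.sqrt h1)) h2

theorem hasDerivAt_chartInv (hs : 0 < s) (hy : y ∈ Set.Icc (0 : ℝ) 1) :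
    HasDerivAt (chartInv s) (den s (chartInv s y) ^ 2 / num s (chartInv s y)) y := by
  have hd := ((contDiffAt_chartInv hs hy).differentiableAt (by simp)).hasDerivAt
  have hm := chartInv_mem hs hy
  -- The composite is known to be the identity only on `[0,1]`, so derivatives within that interval
  -- are compared.
  have h1 : HasDerivWithinAt (chart s ∘ chartInv s)
      (num s (chartInv s y) / den s (chartInv s y) ^ 2 * deriv (chartInv s) y) (Set.Icc 0 1) y :=
    ((hasDerivAt_chart hs hm).comp y hd).hasDerivWithinAt
  have h2 : HasDerivWithinAt (chart s ∘ chartInv s) 1 (Set.Icc 0 1) y :=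
    (hasDerivWithinAt_id y _).congr (fun x hx => chart_chartInv hs hx) (chart_chartInv hs hy)
  have h3 := (uniqueDiffOn_Icc zero_lt_one y hy).eq_deriv _ h1 h2
  have hn := num_pos hs hm
  have hdn := den_pos hs hm
  have h4 : deriv (chartInv s) y = den s (chartInv s y) ^ 2 / num s (chartInv s y) := by
    rw [eq_div_iff hn.ne']
    field_simp at h3
    linarith
  rwa [h4] at hd

end PixtonTsuboi

namespace ContigPair

theorem len_pos (P : ContigPair) : 0 < P.len := sub_pos.2 P.hbc

theorem lenLeft_pos (P : ContigPair) : 0 < P.lenLeft := sub_pos.2 P.hab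

/-- The quotient `|I'| / |I|`. -/
def ratio (P : ContigPair) : ℝ := P.lenLeft / P.len

theorem ratio_pos (P : ContigPair) : 0 < P.ratio := div_pos P.lenLeft_pos P.len_pos

/-- The affine map from `[b,c]` onto `[0,1]` reversing the orientation. -/
def toUnit (P : ContigPair) (y : ℝ) : ℝ := (P.c - y) / P.len

theorem toUnit_mem (P : ContigPair) {y : ℝ} (hy : y ∈ P.main) :
    P.toUnit y ∈ Set.Icc (0 : ℝ) 1 :=
  ⟨div_nonneg (sub_nonneg.2 hy.2) P.len_pos.le,
    (div_le_one P.len_pos).2 (sub_le_sub_left hy.1 _)⟩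

theorem hasDerivAt_toUnit (P : ContigPair) (y : ℝ) :
    HasDerivAt P.toUnit (-1 / P.len) y :=
  ((hasDerivAt_id y).const_sub P.c).div_const P.len

theorem toUnit_b (P : ContigPair) : P.toUnit P.b = 1 := div_self P.len_pos.ne'

theorem toUnit_c (P : ContigPair) : P.toUnit P.c = 0 := by simp [toUnit]

theorem toUnit_sub_mul (P : ContigPair) (u : ℝ) : P.toUnit (P.c - P.len * u) = u := by
  have := P.len_pos.ne'
  simp only [toUnit]; field_simp; ring

theorem b_mem (P : ContigPair) : P.b ∈ P.main := Set.left_mem_Icc.2 P.hbc.le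

theorem c_mem (P : ContigPair) : P.c ∈ P.main := Set.right_mem_Icc.2 P.hbc.le

theorem uniqueDiffOn_main (P : ContigPair) : UniqueDiffOn ℝ P.main := uniqueDiffOn_Icc P.hbc

end ContigPair

/-! ### Maps between contiguous pairs and their distortion -/

namespace PixtonTsuboi

variable (P Q R : ContigPair) {x : ℝ}

/-- The parameter in `[0,1]` of a point of `[b,c]`. -/
def param (y : ℝ) : ℝ := chartInv P.ratio (P.toUnit y)

/-- The maps of the Pixton–Tsuboi family. -/
def map (y : ℝ) : ℝ := Q.c - Q.len * chart Q.ratio (param P y)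

/-- The derivative of `map P Q`. -/
def dmap (y : ℝ) : ℝ := Q.len / P.len * (num Q.ratio (param P y) / num P.ratio (param P y)) *
  (den P.ratio (param P y) / den Q.ratio (param P y)) ^ 2

variable {P}

theorem param_mem (hx : x ∈ P.main) : param P x ∈ Set.Icc (0 : ℝ) 1 :=
  chartInv_mem P.ratio_pos (P.toUnit_mem hx)

theorem param_b : param P P.b = 1 := by rw [param, P.toUnit_b, chartInv_one P.ratio_pos]

theorem param_c : param P P.c = 0 := by rw [param, P.toUnit_c, chartInv_zero P.ratio_pos]

variable {Q}

theorem map_b : map P Q P.b = Q.b := by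
  rw [map, param_b, chart_one, ContigPair.len]; ring

theorem map_c : map P Q P.c = Q.c := by
  rw [map, param_c, chart_zero]; ring

theorem map_mapsTo : Set.MapsTo (map P Q) P.main Q.main := by
  intro x hx
  have h := chart_mem Q.ratio_pos (param_mem hx)
  have hl := Q.len_pos
  refine ⟨?_, ?_⟩
  · have := mul_le_mul_of_nonneg_left h.2 hl.le
    simp only [map]
    have : Q.len = Q.c - Q.b := rfl
    linarith
  · have := mul_nonneg hl.le h.1
    simp only [map]
    linarith

/-- The family is a coboundary: a point of `P` and its image in `Q` have the same parameter in
`[0,1]`, so the intermediate chart cancels. -/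
theorem map_comp (R : ContigPair) (hx : x ∈ P.main) : map Q R (map P Q x) = map P R x := by
  have h : param Q (map P Q x) = param P x := by
    rw [param, map, Q.toUnit_sub_mul, chartInv_chart Q.ratio_pos (param_mem hx)]
  rw [map, h, map]

theorem map_self (hx : x ∈ P.main) : map P P x = x := by
  rw [map, param, chart_chartInv P.ratio_pos (P.toUnit_mem hx), ContigPair.toUnit,
    mul_div_cancel₀ _ P.len_pos.ne']
  ring

theorem map_bijOn : Set.BijOn (map P Q) P.main Q.main :=
  Set.InvOn.bijOn (f' := map Q P)
    ⟨fun _ hx => by rw [map_comp _ hx, map_self hx], fun _ hx => by rw [map_comp _ hx, map_self hx]⟩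
    map_mapsTo map_mapsTo

theorem dmap_pos (hx : x ∈ P.main) : 0 < dmap P Q x := by
  have h := param_mem hx
  have h1 := num_pos P.ratio_pos h
  have h2 := num_pos Q.ratio_pos h
  have h3 := den_pos P.ratio_pos h
  have h4 := den_pos Q.ratio_pos h
  have h5 := P.len_pos
  have h6 := Q.len_pos
  unfold dmap
  positivity

/-- As `toUnit` reverses orientation, `b` has parameter `1`, where a chart has slope `ratio`; this
turns `Q.len / P.len` into the quotient of the left neighbours. At `c` all charts have slope `1`. -/
theorem dmap_b : dmap P Q P.b = Q.lenLeft / P.lenLeft := by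
  have h5 := P.len_pos.ne'
  have h6 := Q.len_pos.ne'
  have h7 := P.lenLeft_pos.ne'
  rw [dmap, param_b]
  have e1 : num Q.ratio 1 = Q.lenLeft / Q.len := by simp [num, ContigPair.ratio]
  have e2 : num P.ratio 1 = P.lenLeft / P.len := by simp [num, ContigPair.ratio]
  have e3 : ∀ s, den s 1 = 1 := fun s => by simp [den]
  rw [e1, e2, e3, e3]
  field_simp

theorem dmap_c : dmap P Q P.c = Q.len / P.len := by
  rw [dmap, param_c]
  simp [num, den]

theorem hasDerivAt_param (hx : x ∈ P.main) : HasDerivAt (param P)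
    (den P.ratio (param P x) ^ 2 / num P.ratio (param P x) * (-1 / P.len)) x :=
  (hasDerivAt_chartInv P.ratio_pos (P.toUnit_mem hx)).comp x (P.hasDerivAt_toUnit x)

theorem hasDerivAt_map (hx : x ∈ P.main) : HasDerivAt (map P Q) (dmap P Q x) x := by
  have h := param_mem hx
  have h2 := (den_pos Q.ratio_pos h).ne'
  have h1 := (num_pos P.ratio_pos h).ne'
  have h5 := P.len_pos.ne'
  refine ((((hasDerivAt_chart Q.ratio_pos h).comp x (hasDerivAt_param hx)).const_mul
    Q.len).const_sub Q.c).congr_deriv ?_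
  rw [dmap]
  field_simp

theorem derivWithin_map (hx : x ∈ P.main) : derivWithin (map P Q) P.main x = dmap P Q x :=
  (hasDerivAt_map hx).hasDerivWithinAt.derivWithin (P.uniqueDiffOn_main x hx)

theorem contDiffOn_map : ContDiffOn ℝ ∞ (map P Q) P.main := by
  intro x hx
  refine ContDiffAt.contDiffWithinAt ?_
  have h1 : ContDiffAt ℝ ∞ P.toUnit x := by unfold ContigPair.toUnit; fun_prop
  have h2 : ContDiffAt ℝ ∞ (param P) x :=
    (contDiffAt_chartInv P.ratio_pos (P.toUnit_mem hx)).comp x h1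
  have h3 := (contDiffAt_chart Q.ratio_pos (param_mem hx)).comp x h2
  exact contDiffAt_const.sub (contDiffAt_const.mul h3)

/-- The derivative of `log (dmap P Q)`. -/
def dlog (P Q : ContigPair) (y : ℝ) : ℝ :=
  ((Q.ratio - 1) * (2 * param P y) / num Q.ratio (param P y)
    - (P.ratio - 1) * (2 * param P y) / num P.ratio (param P y)
    + 2 * ((P.ratio - 1) * (1 - 2 * param P y) / den P.ratio (param P y)
      - (Q.ratio - 1) * (1 - 2 * param P y) / den Q.ratio (param P y)))
    * (den P.ratio (param P y) ^ 2 / num P.ratio (param P y) * (-1 / P.len))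

theorem hasDerivWithinAt_log_dmap (hx : x ∈ P.main) :
    HasDerivWithinAt (fun y => Real.log (dmap P Q y)) (dlog P Q x) P.main x := by
  have hN : ∀ T : ContigPair, HasDerivAt (fun y => Real.log (num T.ratio (param P y)))
      ((T.ratio - 1) * (2 * param P x) / num T.ratio (param P x) *
        (den P.ratio (param P x) ^ 2 / num P.ratio (param P x) * (-1 / P.len))) x := fun T => by
    refine (((hasDerivAt_num T.ratio (param P x)).comp x (hasDerivAt_param hx)).log
      (num_pos T.ratio_pos (param_mem hx)).ne').congr_deriv ?_
    change _ / num T.ratio (param P x) = _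
    ring
  have hD : ∀ T : ContigPair, HasDerivAt (fun y => Real.log (den T.ratio (param P y)))
      ((T.ratio - 1) * (1 - 2 * param P x) / den T.ratio (param P x) *
        (den P.ratio (param P x) ^ 2 / num P.ratio (param P x) * (-1 / P.len))) x := fun T => by
    refine (((hasDerivAt_den T.ratio (param P x)).comp x (hasDerivAt_param hx)).log
      (den_pos T.ratio_pos (param_mem hx)).ne').congr_deriv ?_
    change _ / den T.ratio (param P x) = _
    ring
  have key : ∀ y ∈ P.main, Real.log (dmap P Q y) = Real.log (Q.len / P.len) +
      ((Real.log (num Q.ratio (param P y)) - Real.log (num P.ratio (param P y))) +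
      2 * (Real.log (den P.ratio (param P y)) - Real.log (den Q.ratio (param P y)))) := by
    intro y hy
    have h := param_mem hy
    have h1 := (num_pos P.ratio_pos h).ne'
    have h2 := (num_pos Q.ratio_pos h).ne'
    have h3 := (den_pos P.ratio_pos h).ne'
    have h4 := (den_pos Q.ratio_pos h).ne'
    have h5 := P.len_pos.ne'
    have h6 := Q.len_pos.ne'
    rw [dmap, Real.log_mul (by positivity) (by positivity), Real.log_mul (by positivity)
      (by positivity), Real.log_pow, Real.log_div h2 h1, Real.log_div h3 h4]
    push_cast
    ring
  have := ((((hN Q).sub (hN P)).add (((hD P).sub (hD Q)).const_mul 2)).const_add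
    (Real.log (Q.len / P.len))).hasDerivWithinAt (s := P.main)
  refine (this.congr_deriv ?_).congr key (key x hx)
  rw [dlog]; ring

/-- Since `num` and `den` are affine in the ratio, both differences in `dlog` factor through
`Q.ratio - P.ratio`. An arbitrary `κ` is allowed, since neighbouring intervals of the final family
are comparable only up to some constant, not necessarily `2`. -/
theorem abs_dlog_le (h0 : 0 < κ) (h1 : κ ≤ 1) (hP : κ ≤ P.ratio) (hP' : P.ratio ≤ 1 / κ)
    (hQ : κ ≤ Q.ratio) (hx : x ∈ P.main) :
    |dlog P Q x| ≤ 4 / κ ^ 5 / P.len * |Q.ratio - P.ratio| := by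
  have hz := param_mem hx
  set z := param P x with hzdef
  set s := P.ratio with hs
  set t := Q.ratio
  have n1 := num_mem h1 hP hz
  have n2 := num_mem h1 hQ hz
  have d1 := den_mem h1 hP hz
  have d2 := den_mem h1 hQ hz
  have d3 : den s z ≤ 1 / κ := den_le hP' (by rw [le_div_iff₀ h0]; linarith) hz
  have n1' := h0.trans_le n1
  have n2' := h0.trans_le n2
  have d1' := h0.trans_le d1
  have d2' := h0.trans_le d2
  have hl := P.len_pos
  have key : dlog P Q x = (2 * z / (num s z * num t z)
      - 2 * (1 - 2 * z) / (den s z * den t z)) * (t - s)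
      * (den s z ^ 2 / num s z * (-1 / P.len)) := by
    rw [dlog]
    congr 1
    change (t - 1) * (2 * z) / num t z - (s - 1) * (2 * z) / num s z
      + 2 * ((s - 1) * (1 - 2 * z) / den s z - (t - 1) * (1 - 2 * z) / den t z) = _
    rw [div_sub_div _ _ n2'.ne' n1'.ne', div_sub_div _ _ d1'.ne' d2'.ne']
    have e1 : (t - 1) * (2 * z) * num s z - num t z * ((s - 1) * (2 * z))
        = 2 * z * (t - s) := by simp only [num]; ring
    have e2 : (s - 1) * (1 - 2 * z) * den t z - den s z * ((t - 1) * (1 - 2 * z))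
        = - ((1 - 2 * z) * (t - s)) := by simp only [den]; ring
    rw [e1, e2]
    field_simp
    ring
  have b1 : |2 * z / (num s z * num t z)| ≤ 2 / (κ * κ) := by
    rw [abs_div, abs_of_pos (mul_pos n1' n2'), abs_of_nonneg (by linarith [hz.1])]
    exact div_le_div₀ (by norm_num) (by linarith [hz.2]) (by positivity)
      (mul_le_mul n1 n2 h0.le n1'.le)
  have b2 : |2 * (1 - 2 * z) / (den s z * den t z)| ≤ 2 / (κ * κ) := by
    rw [abs_div, abs_of_pos (mul_pos d1' d2')]
    refine div_le_div₀ (by norm_num) ?_ (by positivity) (mul_le_mul d1 d2 h0.le d1'.le)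
    rw [abs_le]; constructor <;> linarith [hz.1, hz.2]
  have b3 : |den s z ^ 2 / num s z * (-1 / P.len)| ≤ (1 / κ) ^ 2 / κ * (1 / P.len) := by
    rw [abs_mul, abs_div, abs_div, abs_of_pos n1', abs_of_pos hl, abs_of_nonneg (sq_nonneg _),
      abs_neg, abs_one]
    gcongr
  rw [key, abs_mul, abs_mul]
  -- Each of the two fractions costs `2 / κ ^ 2`, and the derivative of the parameter costs `1 / κ ^
  -- 3`.
  calc _ ≤ (2 / (κ * κ) + 2 / (κ * κ)) * |t - s| * ((1 / κ) ^ 2 / κ * (1 / P.len)) := by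
        gcongr
        exact (abs_sub _ _).trans (add_le_add b1 b2)
    _ = _ := by field_simp; ring

theorem isPixtonTsuboi_map : IsPixtonTsuboi map where
  bijOn _ _ := map_bijOn
  smooth _ _ := contDiffOn_map
  equivariance _ _ R _ hx := map_comp R hx
  deriv_left P Q := by rw [derivWithin_map P.b_mem, dmap_b]
  deriv_right P Q := by rw [derivWithin_map P.c_mem, dmap_c]
  regularity := by
    -- This is the constant of `abs_dlog_le` at `κ = 1 / 2`; the last factor bounds `P.ratio`, which
    -- is extracted from `Q.ratio - P.ratio`.
    refine ⟨4 / (1 / 2) ^ 5 * 2, fun P Q h x hx => ?_⟩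
    have e1 := P.len_pos
    have e2 := P.lenLeft_pos
    have e3 := Q.len_pos
    have e4 := Q.lenLeft_pos
    have hb : ∀ u ∈ ({P.lenLeft, P.len, Q.lenLeft, Q.len} : Set ℝ),
        ∀ v ∈ ({P.lenLeft, P.len, Q.lenLeft, Q.len} : Set ℝ), u ≤ 2 * v := by
      intro u hu v hv
      have h1 : u ≤ max (max P.lenLeft P.len) (max Q.lenLeft Q.len) := by
        rcases hu with rfl | rfl | rfl | rfl <;> simp
      have h2 : min (min P.lenLeft P.len) (min Q.lenLeft Q.len) ≤ v := by
        rcases hv with rfl | rfl | rfl | rfl <;> simp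
      linarith
    have r1 : 1 / 2 ≤ P.ratio := by
      rw [ContigPair.ratio, le_div_iff₀ e1]
      linarith [hb P.len (by simp) P.lenLeft (by simp)]
    have r2 : P.ratio ≤ 2 := by
      rw [ContigPair.ratio, div_le_iff₀ e1]
      exact hb P.lenLeft (by simp) P.len (by simp)
    have r3 : 1 / 2 ≤ Q.ratio := by
      rw [ContigPair.ratio, le_div_iff₀ e3]
      linarith [hb Q.len (by simp) Q.lenLeft (by simp)]
    have hd : derivWithin (fun y => Real.log (derivWithin (map P Q) P.main y)) P.main x
        = dlog P Q x := by
      rw [derivWithin_congr (f := fun y => Real.log (dmap P Q y))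
        (fun y hy => by rw [derivWithin_map hy]) (by rw [derivWithin_map hx])]
      exact (hasDerivWithinAt_log_dmap hx).derivWithin (P.uniqueDiffOn_main x hx)
    rw [hd]
    refine (abs_dlog_le (by norm_num) (by norm_num) r1 (by linarith) r3 hx).trans ?_
    have e5 : Q.ratio - P.ratio = P.ratio * (P.len / Q.len * (Q.lenLeft / P.lenLeft) - 1) := by
      simp only [ContigPair.ratio]
      field_simp
    rw [e5, abs_mul, abs_of_pos P.ratio_pos]
    calc _ ≤ 4 / (1 / 2) ^ 5 / P.len * (2 * |P.len / Q.len * (Q.lenLeft / P.lenLeft) - 1|) := by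
          gcongr
      _ = _ := by ring

theorem dmap_le (h0 : 0 < κ) (h1 : κ ≤ 1) (hP : κ ≤ P.ratio) (hP' : P.ratio ≤ 1 / κ)
    (hQ : κ ≤ Q.ratio) (hQ' : Q.ratio ≤ 1 / κ) (hx : x ∈ P.main) :
    dmap P Q x ≤ Q.len / P.len * (1 / κ ^ 6) := by
  have hz := param_mem hx
  have hk : 1 ≤ 1 / κ := by rw [le_div_iff₀ h0]; linarith
  have n1 := num_mem h1 hP hz
  have d2 := den_mem h1 hQ hz
  have n2' := (num_pos Q.ratio_pos hz).le
  have d1' := (den_pos P.ratio_pos hz).le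
  have hl := P.len_pos
  have hl' := Q.len_pos
  have i1 : num Q.ratio (param P x) / num P.ratio (param P x) ≤ (1 / κ) / κ :=
    div_le_div₀ (by positivity) (num_le hQ' hk hz) h0 n1
  have i2 : den P.ratio (param P x) / den Q.ratio (param P x) ≤ (1 / κ) / κ :=
    div_le_div₀ (by positivity) (den_le hP' hk hz) h0 d2
  have i3 : 0 ≤ den P.ratio (param P x) / den Q.ratio (param P x) :=
    div_nonneg d1' (h0.le.trans d2)
  calc _ ≤ Q.len / P.len * ((1 / κ) / κ) * ((1 / κ) / κ) ^ 2 := by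
        unfold dmap
        gcongr
    _ = _ := by field_simp

/-- Variation of the derivative on one interval. -/
theorem abs_dmap_sub_le (h0 : 0 < κ) (h1 : κ ≤ 1) (hP : κ ≤ P.ratio) (hP' : P.ratio ≤ 1 / κ)
    (hQ : κ ≤ Q.ratio) (hQ' : Q.ratio ≤ 1 / κ) (hx : x ∈ P.main) (hy : y ∈ P.main) :
    |dmap P Q x - dmap P Q y| ≤ 4 / κ ^ 11 * (Q.len / P.len) * |Q.ratio - P.ratio|
      * (|x - y| / P.len) := by
  have hl := P.len_pos
  have hl' := Q.len_pos
  have hlog : |Real.log (dmap P Q x) - Real.log (dmap P Q y)|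
      ≤ 4 / κ ^ 5 / P.len * |Q.ratio - P.ratio| * |x - y| := by
    have := (convex_Icc P.b P.c).norm_image_sub_le_of_norm_hasDerivWithin_le
      (f := fun y => Real.log (dmap P Q y)) (f' := dlog P Q)
      (fun u hu => hasDerivWithinAt_log_dmap hu)
      (fun u hu => abs_dlog_le h0 h1 hP hP' hQ hu) hy hx
    simpa using this
  -- By `1 - exp (-u) ≤ u`, the oscillation of the logarithm times an upper bound of the values
  -- controls the oscillation of the values.
  have hexp : ∀ a b B : ℝ, 0 < a → 0 < b → a ≤ B → b ≤ B →
      |a - b| ≤ B * |Real.log a - Real.log b| := by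
    have aux : ∀ a b B : ℝ, 0 < a → 0 < b → a ≤ B → b ≤ a →
        |a - b| ≤ B * |Real.log a - Real.log b| := by
      intro a b B ha hb haB hba
      have hlog0 : Real.log b ≤ Real.log a := Real.log_le_log hb hba
      rw [abs_of_nonneg (sub_nonneg.2 hba), abs_of_nonneg (sub_nonneg.2 hlog0)]
      have h := Real.add_one_le_exp (Real.log b - Real.log a)
      rw [Real.exp_sub, Real.exp_log ha, Real.exp_log hb, le_div_iff₀ ha] at h
      nlinarith [mul_le_mul_of_nonneg_right haB (sub_nonneg.2 hlog0)]
    intro a b B ha hb haB hbB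
    rcases le_total b a with h | h
    · exact aux a b B ha hb haB h
    · rw [abs_sub_comm, abs_sub_comm (Real.log a)]
      exact aux b a B hb ha hbB h
  calc _ ≤ Q.len / P.len * (1 / κ ^ 6) * (4 / κ ^ 5 / P.len * |Q.ratio - P.ratio| * |x - y|) :=
        (hexp _ _ _ (dmap_pos hx) (dmap_pos hy) (dmap_le h0 h1 hP hP' hQ hQ' hx)
          (dmap_le h0 h1 hP hP' hQ hQ' hy)).trans (by gcongr)
    _ = _ := by field_simp

end PixtonTsuboi
end

noncomputable section

/-! ### Estimates of the weights -/

/-! ### Increments of real powers -/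

section RealPowers

theorem abs_rpow_sub_two_mul {p : ℝ} (hp : 1 < p) (x : ℝ) :
    |(|x| ^ (p - 2) * x)| = |x| ^ (p - 1) := by
  rcases eq_or_ne x 0 with rfl | hx
  · simp [Real.zero_rpow (sub_pos.2 hp).ne']
  · rw [abs_mul, abs_of_nonneg (Real.rpow_nonneg (abs_nonneg _) _),
      ← Real.rpow_add_one (abs_pos.2 hx).ne']
    ring_nf

theorem abs_abs_rpow_sub_le {p : ℝ} (hp : 1 < p) {x y M : ℝ} (hx : |x| ≤ M) (hy : |y| ≤ M) :
    |(|x| ^ p - |y| ^ p)| ≤ p * M ^ (p - 1) * |x - y| := by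
  have := (convex_Icc (-M) M).norm_image_sub_le_of_norm_hasDerivWithin_le
    (f := fun x : ℝ => |x| ^ p) (f' := fun x => p * |x| ^ (p - 2) * x) (C := p * M ^ (p - 1))
    (fun u _ => (hasDerivAt_abs_rpow u hp).hasDerivWithinAt)
    (fun u hu => by
      rw [Real.norm_eq_abs, mul_assoc, abs_mul, abs_rpow_sub_two_mul hp, abs_of_pos (by linarith)]
      have : |u| ≤ M := abs_le.2 hu
      gcongr) (abs_le.1 hy) (abs_le.1 hx)
  simpa using this

/-- The derivative of `|x| ^ r / r` is `(r - 1)`-Hölder if `1 < r ≤ 2`. -/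
theorem abs_signed_rpow_sub_le {r : ℝ} (hr : 1 < r) (hr2 : r ≤ 2) (x y : ℝ) :
    |(|x| ^ (r - 2) * x - |y| ^ (r - 2) * y)| ≤ 2 * |x - y| ^ (r - 1) := by
  have ht : 0 < r - 1 := sub_pos.2 hr
  have hpos : ∀ x : ℝ, 0 ≤ x → |x| ^ (r - 2) * x = x ^ (r - 1) := fun x hx => by
    have := abs_rpow_sub_two_mul hr x
    rw [abs_of_nonneg (mul_nonneg (Real.rpow_nonneg (abs_nonneg _) _) hx)] at this
    rw [this, abs_of_nonneg hx]
  have hneg : ∀ x : ℝ, x ≤ 0 → |x| ^ (r - 2) * x = - (-x) ^ (r - 1) := fun x hx => by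
    rw [← hpos (-x) (by linarith), abs_neg]; ring
  -- Subadditivity of `t ↦ t ^ (r - 1)`, valid as `0 < r - 1 ≤ 1`. The factor `2` is needed only for
  -- arguments of opposite signs, whose terms are bounded separately.
  have hmono : ∀ x y : ℝ, 0 ≤ y → y ≤ x → |x ^ (r - 1) - y ^ (r - 1)| ≤ (x - y) ^ (r - 1) := by
    intro x y hy hxy
    rw [abs_of_nonneg (sub_nonneg.2 (Real.rpow_le_rpow hy hxy ht.le))]
    have := Real.rpow_add_le_add_rpow (sub_nonneg.2 hxy) hy ht.le (by linarith : r - 1 ≤ 1)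
    rw [sub_add_cancel] at this
    linarith
  have main : ∀ x y : ℝ, y ≤ x →
      |(|x| ^ (r - 2) * x - |y| ^ (r - 2) * y)| ≤ 2 * |x - y| ^ (r - 1) := by
    intro x y hxy
    have h0 : 0 ≤ (x - y) ^ (r - 1) := Real.rpow_nonneg (sub_nonneg.2 hxy) _
    rw [abs_of_nonneg (sub_nonneg.2 hxy)]
    rcases le_total 0 y with hy | hy
    · rw [hpos y hy, hpos x (hy.trans hxy)]
      linarith [hmono x y hy hxy]
    rcases le_total 0 x with hx | hx
    · rw [hpos x hx, hneg y hy, sub_neg_eq_add, abs_of_nonneg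
        (add_nonneg (Real.rpow_nonneg hx _) (Real.rpow_nonneg (by linarith) _))]
      have h1 : x ^ (r - 1) ≤ (x - y) ^ (r - 1) := Real.rpow_le_rpow hx (by linarith) ht.le
      have h2 : (-y) ^ (r - 1) ≤ (x - y) ^ (r - 1) :=
        Real.rpow_le_rpow (by linarith) (by linarith) ht.le
      linarith
    · rw [hneg x hx, hneg y hy]
      have := hmono (-y) (-x) (by linarith) (by linarith)
      rw [show -y - -x = x - y by ring] at this
      rw [show -(-x) ^ (r - 1) - -(-y) ^ (r - 1) = (-y) ^ (r - 1) - (-x) ^ (r - 1) by ring]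
      linarith
  rcases le_total y x with h | h
  · exact main x y h
  · rw [abs_sub_comm, abs_sub_comm x y]
    exact main y x h

/-- Up to sign this is the increment of `|x - s| ^ r - |y - s| ^ r` over `s ∈ [0,1]`, and the
derivative in `s` is bounded by the preceding Hölder estimate. The gain is a bound by `x - y` alone,
independent of the size of `x` and `y`. -/
theorem abs_second_difference_rpow_le {r : ℝ} (hr : 1 < r) (hr2 : r ≤ 2) (x y : ℝ) :
    |(|x| ^ r - |x - 1| ^ r) - (|y| ^ r - |y - 1| ^ r)| ≤ 2 * r * |x - y| ^ (r - 1) := by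
  have hd : ∀ x s : ℝ, HasDerivAt (fun s => |x - s| ^ r)
      (-(r * |x - s| ^ (r - 2) * (x - s))) s := fun x s => by
    have := (hasDerivAt_abs_rpow (x - s) hr).comp s ((hasDerivAt_id s).const_sub x)
    exact this.congr_deriv (by ring)
  have := (convex_Icc (0 : ℝ) 1).norm_image_sub_le_of_norm_hasDerivWithin_le
    (f := fun s => |x - s| ^ r - |y - s| ^ r)
    (f' := fun s => -(r * |x - s| ^ (r - 2) * (x - s)) - -(r * |y - s| ^ (r - 2) * (y - s)))
    (C := 2 * r * |x - y| ^ (r - 1))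
    (fun s _ => ((hd x s).sub (hd y s)).hasDerivWithinAt)
    (fun s _ => by
      have h := abs_signed_rpow_sub_le hr hr2 (x - s) (y - s)
      rw [show x - s - (y - s) = x - y by ring] at h
      rw [Real.norm_eq_abs, show -(r * |x - s| ^ (r - 2) * (x - s)) -
        -(r * |y - s| ^ (r - 2) * (y - s)) = -(r * (|x - s| ^ (r - 2) * (x - s) -
          |y - s| ^ (r - 2) * (y - s))) by ring, abs_neg, abs_mul, abs_of_pos (by linarith)]
      nlinarith) (Set.right_mem_Icc.2 zero_le_one) (Set.left_mem_Icc.2 zero_le_one)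
  simp only [sub_zero, Real.norm_eq_abs] at this
  rw [show |x| ^ r - |x - 1| ^ r - (|y| ^ r - |y - 1| ^ r)
    = |x| ^ r - |y| ^ r - (|x - 1| ^ r - |y - 1| ^ r) by ring]
  simpa using this

/-- Mean value inequality in terms of one scale `X`: the derivative has order `X ^ (1 - 1 / p)` and
the increment order `X ^ η`, with `η ≤ 1 / p` keeping `x + h` at the same scale. -/
theorem abs_rpow_add_sub_le {p X x h c η : ℝ} (hp : 1 < p) (hX : 1 ≤ X) (hc : 0 ≤ c)
    (hx : |x| ≤ X ^ (1 / p)) (hh : |h| ≤ c * X ^ η) (hη : η ≤ 1 / p) :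
    |(|x + h| ^ p - |x| ^ p)| ≤ p * (1 + c) ^ (p - 1) * c * X ^ (η + 1 - 1 / p) := by
  have hX0 : 0 < X := by linarith
  have hle : X ^ η ≤ X ^ (1 / p) := Real.rpow_le_rpow_of_exponent_le hX hη
  have hY : 0 ≤ X ^ (1 / p) := Real.rpow_nonneg hX0.le _
  have h1 : |x + h| ≤ (1 + c) * X ^ (1 / p) := by
    have := mul_le_mul_of_nonneg_left hle hc
    linarith [abs_add_le x h]
  have h2 : |x| ≤ (1 + c) * X ^ (1 / p) := by nlinarith
  have h3 := abs_abs_rpow_sub_le hp h1 h2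
  rw [add_sub_cancel_left, Real.mul_rpow (by linarith) hY, ← Real.rpow_mul hX0.le] at h3
  refine h3.trans ?_
  have h4 : X ^ (η + 1 - 1 / p) = X ^ (1 / p * (p - 1)) * X ^ η := by
    rw [← Real.rpow_add hX0]
    congr 1
    field_simp
    ring
  rw [h4]
  have h5 : 0 ≤ (1 + c) ^ (p - 1) := Real.rpow_nonneg (by linarith) _
  calc _ ≤ p * ((1 + c) ^ (p - 1) * X ^ (1 / p * (p - 1))) * (c * X ^ η) := by gcongr
    _ = _ := by ring

end RealPowers

/-! ### The weights under shifts and under the action -/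

namespace LexZ3

theorem ext_coord {v w : LexZ3} (h1 : v.fstCoord = w.fstCoord) (h2 : v.sndCoord = w.sndCoord)
    (h3 : v.trdCoord = w.trdCoord) : v = w :=
  Prod.ext h1 (Prod.ext h2 h3)

@[simp] theorem fstCoord_mk (i j k : ℤ) : (mk i j k).fstCoord = i := rfl
@[simp] theorem sndCoord_mk (i j k : ℤ) : (mk i j k).sndCoord = j := rfl
@[simp] theorem trdCoord_mk (i j k : ℤ) : (mk i j k).trdCoord = k := rfl
@[simp] theorem fstCoord_shift (n : ℤ) (v : LexZ3) : (v.shift n).fstCoord = v.fstCoord := rfl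
@[simp] theorem sndCoord_shift (n : ℤ) (v : LexZ3) : (v.shift n).sndCoord = v.sndCoord := rfl
@[simp] theorem trdCoord_shift (n : ℤ) (v : LexZ3) : (v.shift n).trdCoord = v.trdCoord + n := rfl

@[simp] theorem shift_zero (v : LexZ3) : v.shift 0 = v := ext_coord rfl rfl (add_zero _)

@[simp] theorem shift_shift (m n : ℤ) (v : LexZ3) : (v.shift m).shift n = v.shift (m + n) :=
  ext_coord rfl rfl (by simp only [trdCoord_shift]; ring)

theorem act_shift (g : N4) (n : ℤ) (v : LexZ3) : act g (v.shift n) = (act g v).shift n :=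
  ext_coord rfl rfl (by
    simp only [act, trdCoord_mk, trdCoord_shift, fstCoord_shift, sndCoord_shift]; ring)

/-- The inverse of the weight `lexWeight 8 8 r`. -/
def denom (r : ℝ) (v : LexZ3) : ℝ :=
  |(v.fstCoord : ℝ)| ^ (8 : ℝ) + |(v.sndCoord : ℝ)| ^ (8 : ℝ) + |(v.trdCoord : ℝ)| ^ r + 1

variable {r : ℝ} (v : LexZ3)

theorem lexWeight_eq (r : ℝ) : lexWeight 8 8 r v = 1 / denom r v := rfl

theorem one_le_denom : 1 ≤ denom r v := by
  have h1 := Real.rpow_nonneg (abs_nonneg (v.fstCoord : ℝ)) 8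
  have h2 := Real.rpow_nonneg (abs_nonneg (v.sndCoord : ℝ)) 8
  have h3 := Real.rpow_nonneg (abs_nonneg (v.trdCoord : ℝ)) r
  unfold denom
  linarith

theorem denom_pos : 0 < denom r v := one_pos.trans_le (one_le_denom v)

theorem abs_le_denom_rpow {p x X : ℝ} (hp : 0 < p) (h : |x| ^ p ≤ X) : |x| ≤ X ^ (1 / p) := by
  have := Real.rpow_le_rpow (Real.rpow_nonneg (abs_nonneg x) p) h (by positivity : 0 ≤ 1 / p)
  rwa [← Real.rpow_mul (abs_nonneg x), mul_one_div_cancel hp.ne', Real.rpow_one] at this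

theorem abs_fst_le : |(v.fstCoord : ℝ)| ≤ denom r v ^ (1 / 8 : ℝ) := by
  have h2 := Real.rpow_nonneg (abs_nonneg (v.sndCoord : ℝ)) 8
  have h3 := Real.rpow_nonneg (abs_nonneg (v.trdCoord : ℝ)) r
  exact abs_le_denom_rpow (by norm_num) (by unfold denom; linarith)

theorem abs_snd_le : |(v.sndCoord : ℝ)| ≤ denom r v ^ (1 / 8 : ℝ) := by
  have h2 := Real.rpow_nonneg (abs_nonneg (v.fstCoord : ℝ)) 8
  have h3 := Real.rpow_nonneg (abs_nonneg (v.trdCoord : ℝ)) r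
  exact abs_le_denom_rpow (by norm_num) (by unfold denom; linarith)

theorem abs_trd_le (hr : 0 < r) : |(v.trdCoord : ℝ)| ≤ denom r v ^ (1 / r) := by
  have h2 := Real.rpow_nonneg (abs_nonneg (v.fstCoord : ℝ)) 8
  have h3 := Real.rpow_nonneg (abs_nonneg (v.sndCoord : ℝ)) 8
  exact abs_le_denom_rpow hr (by unfold denom; linarith)

theorem denom_shift_sub (hr : 1 < r) (n : ℤ) : ∃ C : ℝ, 0 ≤ C ∧ ∀ v : LexZ3,
    |denom r (v.shift n) - denom r v| ≤ C * denom r v ^ (1 - 1 / r) := by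
  refine ⟨r * (1 + |(n : ℝ)|) ^ (r - 1) * |(n : ℝ)|, by positivity, fun v => ?_⟩
  have := abs_rpow_add_sub_le hr (one_le_denom (r := r) v) (abs_nonneg (n : ℝ))
    (abs_trd_le v (by linarith)) (h := n) (η := 0) (by simp) (by positivity)
  rw [zero_add] at this
  convert this using 2
  simp only [denom, fstCoord_shift, sndCoord_shift, trdCoord_shift]
  push_cast
  ring

/-- The displacement of `k` is a polynomial of degree at most one in each of `i` and `j`, and both
are at most `denom ^ (1 / 8)`; the product `i j` produces the exponent `1 / 4`. -/
theorem act_trd_sub_le (g : N4) : ∃ C : ℝ, 0 ≤ C ∧ ∀ v : LexZ3,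
    |((act g v).trdCoord : ℝ) - v.trdCoord| ≤ C * denom r v ^ (1 / 4 : ℝ) := by
  refine ⟨|(g.1 3 0 : ℝ)| + |(g.1 3 1 : ℝ)| + (|(g.1 2 0 : ℝ)| + |(g.1 2 1 : ℝ)|) *
    (1 + |(g.1 3 2 : ℝ)|), by positivity, fun v => ?_⟩
  have hX : 1 ≤ denom r v ^ (1 / 8 : ℝ) := Real.one_le_rpow (one_le_denom v) (by norm_num)
  have h4 : denom r v ^ (1 / 4 : ℝ) = denom r v ^ (1 / 8 : ℝ) * denom r v ^ (1 / 8 : ℝ) := by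
    rw [← Real.rpow_add (denom_pos v)]; norm_num
  have hi := abs_fst_le (r := r) v
  have hj := abs_snd_le (r := r) v
  rw [h4]
  set X := denom r v ^ (1 / 8 : ℝ)
  have e : ((act g v).trdCoord : ℝ) - v.trdCoord = (g.1 3 0 : ℝ) + g.1 3 1 * v.fstCoord
      - (g.1 2 0 + g.1 2 1 * v.fstCoord) * (v.sndCoord + g.1 3 2) := by
    simp only [act, trdCoord_mk]; push_cast; ring
  rw [e]
  have i1 : |(g.1 3 0 : ℝ) + g.1 3 1 * v.fstCoord|
      ≤ |(g.1 3 0 : ℝ)| * (X * X) + |(g.1 3 1 : ℝ)| * (X * X) := by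
    refine (abs_add_le _ _).trans (add_le_add (le_mul_of_one_le_right (abs_nonneg _)
      (by nlinarith)) ?_)
    rw [abs_mul]
    exact mul_le_mul_of_nonneg_left (by nlinarith) (abs_nonneg _)
  have i2 : |(g.1 2 0 : ℝ) + g.1 2 1 * v.fstCoord| ≤ (|(g.1 2 0 : ℝ)| + |(g.1 2 1 : ℝ)|) * X := by
    rw [add_mul]
    refine (abs_add_le _ _).trans (add_le_add (le_mul_of_one_le_right (abs_nonneg _) hX) ?_)
    rw [abs_mul]
    exact mul_le_mul_of_nonneg_left hi (abs_nonneg _)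
  have i3 : |(v.sndCoord : ℝ) + g.1 3 2| ≤ (1 + |(g.1 3 2 : ℝ)|) * X := by
    rw [add_mul, one_mul]
    exact (abs_add_le _ _).trans (add_le_add hj (le_mul_of_one_le_right (abs_nonneg _) hX))
  refine (abs_sub _ _).trans ?_
  rw [abs_mul]
  have := mul_le_mul i2 i3 (abs_nonneg _) (by positivity)
  linarith

/-- Bounded translations of `i` and `j` contribute the exponent `1 - 1 / 8`. The `k`-term
contributes `1 / 4 + 1 - 1 / r`, which does not exceed `7 / 8` when `1 / r ≥ 3 / 8`. -/
theorem denom_act_sub (hr : 1 < r) (hr2 : 1 / r ≥ 3 / 8) (g : N4) : ∃ C : ℝ, 0 ≤ C ∧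
    ∀ v : LexZ3, |denom r (act g v) - denom r v| ≤ C * denom r v ^ (7 / 8 : ℝ) := by
  obtain ⟨c, hc, hm⟩ := act_trd_sub_le (r := r) g
  refine ⟨8 * (1 + |(g.1 1 0 : ℝ)|) ^ (8 - 1 : ℝ) * |(g.1 1 0 : ℝ)| +
    8 * (1 + |(g.1 3 2 : ℝ)|) ^ (8 - 1 : ℝ) * |(g.1 3 2 : ℝ)| + r * (1 + c) ^ (r - 1) * c,
    by positivity, fun v => ?_⟩
  have hX := one_le_denom (r := r) v
  have h1 := abs_rpow_add_sub_le (p := 8) (by norm_num) hX (abs_nonneg (g.1 1 0 : ℝ))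
    (abs_fst_le v) (h := g.1 1 0) (η := 0) (by simp) (by norm_num)
  have h2 := abs_rpow_add_sub_le (p := 8) (by norm_num) hX (abs_nonneg (g.1 3 2 : ℝ))
    (abs_snd_le v) (h := g.1 3 2) (η := 0) (by simp) (by norm_num)
  have h3 := abs_rpow_add_sub_le hr hX hc (abs_trd_le v (by linarith)) (hm v) (by linarith)
  rw [show (0 + 1 - 1 / 8 : ℝ) = 7 / 8 by norm_num] at h1 h2
  have h4 : denom r v ^ (1 / 4 + 1 - 1 / r) ≤ denom r v ^ (7 / 8 : ℝ) :=
    Real.rpow_le_rpow_of_exponent_le hX (by linarith)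
  have h5 := h3.trans (mul_le_mul_of_nonneg_left h4 (by positivity))
  have e : denom r (act g v) - denom r v =
      (|(v.fstCoord : ℝ) + g.1 1 0| ^ (8 : ℝ) - |(v.fstCoord : ℝ)| ^ (8 : ℝ)) +
      (|(v.sndCoord : ℝ) + g.1 3 2| ^ (8 : ℝ) - |(v.sndCoord : ℝ)| ^ (8 : ℝ)) +
      (|(v.trdCoord : ℝ) + ((act g v).trdCoord - v.trdCoord)| ^ r - |(v.trdCoord : ℝ)| ^ r) := by
    rw [add_sub_cancel]
    simp only [denom, act, fstCoord_mk, sndCoord_mk, trdCoord_mk]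
    push_cast
    ring
  rw [e, add_mul, add_mul]
  exact (abs_add_le _ _).trans (add_le_add ((abs_add_le _ _).trans (add_le_add h1 h2)) h5)

theorem denom_act_le (hr : 1 < r) (hr2 : 1 / r ≥ 3 / 8) (g : N4) : ∃ C : ℝ, 0 < C ∧
    ∀ v : LexZ3, denom r (act g v) ≤ C * denom r v := by
  obtain ⟨C, hC, h⟩ := denom_act_sub hr hr2 g
  refine ⟨1 + C, by linarith, fun v => ?_⟩
  have h1 : denom r v ^ (7 / 8 : ℝ) ≤ denom r v := by
    simpa using Real.rpow_le_rpow_of_exponent_le (one_le_denom v) (by norm_num : (7 / 8 : ℝ) ≤ 1)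
  have h2 := (abs_le.1 (h v)).2
  nlinarith [mul_le_mul_of_nonneg_left h1 hC]

theorem denom_shift_le (hr : 1 < r) (n : ℤ) : ∃ C : ℝ, 0 < C ∧
    ∀ v : LexZ3, denom r (v.shift n) ≤ C * denom r v := by
  obtain ⟨C, hC, h⟩ := denom_shift_sub hr n
  refine ⟨1 + C, by linarith, fun v => ?_⟩
  have h1 : denom r v ^ (1 - 1 / r) ≤ denom r v := by
    have h0 : 0 < 1 / r := by positivity
    simpa using Real.rpow_le_rpow_of_exponent_le (one_le_denom v)
      (by linarith : 1 - 1 / r ≤ 1)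
  have h2 := (abs_le.1 (h v)).2
  nlinarith [mul_le_mul_of_nonneg_left h1 hC]

/-- The distortion of three consecutive weights under the action. -/
theorem denom_cross_sub (hr : 4 / 3 ≤ r) (hr2 : r ≤ 3 / 2) (g : N4) : ∃ C : ℝ, 0 ≤ C ∧
    ∀ v : LexZ3, |denom r (act g v) / denom r ((act g v).shift (-1))
      - denom r v / denom r (v.shift (-1))| ≤ C * denom r v ^ (-(1 / 8 + 1 / r)) := by
  have hr1 : 1 < r := by linarith
  have hr0 : 0 < r := by linarith
  have hinv : 2 / 3 ≤ 1 / r := by rw [div_le_div_iff₀ (by norm_num) hr0]; linarith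
  have hinv8 : 1 / r ≥ 3 / 8 := by linarith
  obtain ⟨c, hc, hm⟩ := act_trd_sub_le (r := r) g
  obtain ⟨A, hA, hA'⟩ := denom_shift_sub hr1 (-1)
  obtain ⟨B, hB, hB'⟩ := denom_act_sub hr1 hinv8 g
  obtain ⟨K, hK, hK'⟩ := denom_shift_le hr1 1
  obtain ⟨T, hT, hT'⟩ := denom_act_le hr1 hinv8 g⁻¹
  obtain ⟨U, hU, hU'⟩ := denom_shift_le hr1 (-1)
  refine ⟨(A * (B * U ^ (7 / 8 : ℝ)) + U * (2 * r * c ^ (r - 1))) * (K * (K * T)),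
    by positivity, fun v => ?_⟩
  set X := denom r v
  have hX1 : 1 ≤ X := one_le_denom v
  have hX0 : 0 < X := by linarith
  set a := denom r (v.shift (-1)) with ha
  set b := denom r ((act g v).shift (-1)) with hb
  have ha0 : 0 < a := denom_pos _
  have hb0 : 0 < b := denom_pos _
  have hXa : X ≤ K * a := by
    have := hK' (v.shift (-1))
    rwa [shift_shift, neg_add_cancel, shift_zero] at this
  -- Lower bounds come from the upper ones for the inverse motions: back by `g⁻¹`, and forward by
  -- the shift `1`.
  have hXb : X ≤ (K * T) * b := by
    have h1 := hT' (act g v)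
    rw [← act_mul, inv_mul_cancel, act_one] at h1
    have h2 := hK' ((act g v).shift (-1))
    rw [shift_shift, neg_add_cancel, shift_zero] at h2
    calc X ≤ T * denom r (act g v) := h1
      _ ≤ T * (K * b) := by gcongr
      _ = _ := by ring
  have haU : a ≤ U * X := hU' v
  have hda : |X - a| ≤ A * X ^ (1 - 1 / r) := by rw [abs_sub_comm]; exact hA' v
  have hba : |b - a| ≤ (B * U ^ (7 / 8 : ℝ)) * X ^ (7 / 8 : ℝ) := by
    have := hB' (v.shift (-1))
    rw [act_shift] at this
    refine this.trans ?_
    rw [mul_assoc, ← Real.mul_rpow hU.le hX0.le]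
    gcongr
  -- The `i`- and `j`-terms cancel in both differences; a second difference in `k` remains, between
  -- points at distance at most `c * X ^ (1 / 4)`.
  have hdd : |(denom r (act g v) - b) - (X - a)| ≤ (2 * r * c ^ (r - 1)) * X ^ ((r - 1) / 4) := by
    have h1 := abs_second_difference_rpow_le hr1 (by linarith) ((act g v).trdCoord : ℝ) v.trdCoord
    have e : (denom r (act g v) - b) - (X - a) =
        (|((act g v).trdCoord : ℝ)| ^ r - |((act g v).trdCoord : ℝ) - 1| ^ r)
        - (|(v.trdCoord : ℝ)| ^ r - |(v.trdCoord : ℝ) - 1| ^ r) := by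
      simp only [X, ha, hb, denom, fstCoord_shift, sndCoord_shift, trdCoord_shift]
      push_cast
      ring_nf
    rw [e]
    refine h1.trans ?_
    have h2 : |((act g v).trdCoord : ℝ) - v.trdCoord| ^ (r - 1)
        ≤ (c * X ^ (1 / 4 : ℝ)) ^ (r - 1) :=
      Real.rpow_le_rpow (abs_nonneg _) (hm v) (by linarith)
    rw [Real.mul_rpow hc (by positivity), ← Real.rpow_mul hX0.le] at h2
    rw [show (r - 1) / 4 = 1 / 4 * (r - 1) by ring, mul_assoc (2 * r)]
    gcongr
  -- The cross product splits into a second difference, weighted by `a`, and a product of two first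
  -- differences.
  have e : denom r (act g v) / b - X / a =
      (a * ((denom r (act g v) - b) - (X - a)) - (X - a) * (b - a)) / (b * a) := by
    rw [div_sub_div _ _ hb0.ne' ha0.ne']
    congr 1
    ring
  -- This term fixes the final exponent, since `(1 - 1/r) + 7/8 = 2 - (1/8 + 1/r)`.
  have hexp1 : X ^ (1 - 1 / r) * X ^ (7 / 8 : ℝ) = X ^ 2 * X ^ (-(1 / 8 + 1 / r)) := by
    rw [← Real.rpow_add hX0, ← Real.rpow_natCast X 2, ← Real.rpow_add hX0]
    congr 1; push_cast; ring
  -- The second difference is no worse: the comparison of exponents amounts to `1 / r + r / 4 ≤ 9 /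
  -- 8`, true for `4/3 ≤ r ≤ 3/2`.
  have hexp2 : X * X ^ ((r - 1) / 4) ≤ X ^ 2 * X ^ (-(1 / 8 + 1 / r)) := by
    rw [← Real.rpow_natCast X 2, ← Real.rpow_add hX0, ← Real.rpow_one_add' hX0.le (by linarith)]
    refine Real.rpow_le_rpow_of_exponent_le hX1 ?_
    have : 1 / r + r / 4 ≤ 9 / 8 := by
      rw [div_add_div _ _ hr0.ne' (by norm_num), div_le_div_iff₀ (by positivity) (by norm_num)]
      nlinarith [mul_nonneg (sub_nonneg.2 hr) (sub_nonneg.2 hr2)]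
    push_cast
    linarith
  have hnum : |a * ((denom r (act g v) - b) - (X - a)) - (X - a) * (b - a)| ≤
      (A * (B * U ^ (7 / 8 : ℝ)) + U * (2 * r * c ^ (r - 1))) *
        (X ^ 2 * X ^ (-(1 / 8 + 1 / r))) := by
    refine (abs_sub _ _).trans ?_
    rw [abs_mul, abs_mul, abs_of_pos ha0]
    have h1 := mul_le_mul haU hdd (abs_nonneg _) (by positivity)
    have h2 := mul_le_mul hda hba (abs_nonneg _) (by positivity)
    have h3 := mul_le_mul_of_nonneg_left hexp2 (by positivity : 0 ≤ U * (2 * r * c ^ (r - 1)))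
    have h4 : A * X ^ (1 - 1 / r) * (B * U ^ (7 / 8 : ℝ) * X ^ (7 / 8 : ℝ)) =
      A * (B * U ^ (7 / 8 : ℝ)) * (X ^ 2 * X ^ (-(1 / 8 + 1 / r))) := by rw [← hexp1]; ring
    linarith
  rw [e, abs_div, abs_of_pos (mul_pos hb0 ha0), div_le_iff₀ (mul_pos hb0 ha0)]
  refine hnum.trans ?_
  have hXX : X ^ 2 ≤ K * (K * T) * (b * a) := by
    have := mul_le_mul hXa hXb hX0.le (by positivity)
    linarith
  have hE : 0 ≤ X ^ (-(1 / 8 + 1 / r)) := by positivity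
  calc _ ≤ (A * (B * U ^ (7 / 8 : ℝ)) + U * (2 * r * c ^ (r - 1))) *
        (K * (K * T) * (b * a) * X ^ (-(1 / 8 + 1 / r))) := by gcongr
    _ = _ := by ring

end LexZ3
end

noncomputable section

/-! ### Summability, limits along lines, faithfulness of the action -/

namespace LexZ3

/-- Used to majorize by powers of `|k + 1/2|`, which never vanishes on `ℤ`, so that `k = 0` is not
exceptional in the series. -/
theorem abs_add_half_rpow_le {p : ℝ} (hp : 0 < p) (k : ℤ) :
    |(k : ℝ) + 1 / 2| ^ p ≤ 2 ^ p * (|(k : ℝ)| ^ p + 1) := by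
  have h : |(k : ℝ) + 1 / 2| ≤ 2 * max |(k : ℝ)| 1 := by
    refine (abs_add_le _ _).trans ?_
    rw [abs_of_pos (by norm_num : (0 : ℝ) < 1 / 2)]
    linarith [le_max_left |(k : ℝ)| 1, le_max_right |(k : ℝ)| 1]
  refine (Real.rpow_le_rpow (abs_nonneg _) h hp.le).trans ?_
  rw [Real.mul_rpow (by norm_num) (by positivity)]
  gcongr
  rcases max_choice |(k : ℝ)| 1 with h | h <;> rw [h]
  · linarith
  · rw [Real.one_rpow]
    linarith [Real.rpow_nonneg (abs_nonneg (k : ℝ)) p]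

theorem rpow_neg_le_of_le {p t X : ℝ} (hp : 0 < p) (ht : 0 < t) {k : ℤ} (hX0 : 0 < X)
    (hX : |(k : ℝ)| ^ p + 1 ≤ X) :
    X ^ (-t) ≤ (2 ^ p) ^ t * (1 / |(k : ℝ) + 1 / 2| ^ (p * t)) := by
  have hk : 0 < |(k : ℝ) + 1 / 2| := by
    rw [abs_pos]
    intro h
    have : (2 * k + 1 : ℤ) = 0 := by
      have : (2 * k + 1 : ℝ) = 0 := by linarith
      exact_mod_cast this
    omega
  have h := (abs_add_half_rpow_le hp k).trans
    (mul_le_mul_of_nonneg_left hX (by positivity : (0 : ℝ) ≤ 2 ^ p))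
  have h2 := Real.rpow_le_rpow (by positivity) h ht.le
  rw [← Real.rpow_mul hk.le, Real.mul_rpow (by positivity) hX0.le] at h2
  rw [Real.rpow_neg hX0.le, mul_one_div, le_div_iff₀ (by positivity), inv_mul_le_iff₀
    (by positivity)]
  exact h2.trans_eq (mul_comm _ _)

theorem summable_half (s : ℝ) (hs : 1 < s) : Summable fun k : ℤ => 1 / |(k : ℝ) + 1 / 2| ^ s :=
  (Real.summable_one_div_int_add_rpow (1 / 2) s).2 hs

variable {r : ℝ}

theorem fst_le_denom (v : LexZ3) : |(v.fstCoord : ℝ)| ^ (8 : ℝ) + 1 ≤ denom r v := by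
  have h2 := Real.rpow_nonneg (abs_nonneg (v.sndCoord : ℝ)) 8
  have h3 := Real.rpow_nonneg (abs_nonneg (v.trdCoord : ℝ)) r
  unfold denom; linarith

theorem snd_le_denom (v : LexZ3) : |(v.sndCoord : ℝ)| ^ (8 : ℝ) + 1 ≤ denom r v := by
  have h2 := Real.rpow_nonneg (abs_nonneg (v.fstCoord : ℝ)) 8
  have h3 := Real.rpow_nonneg (abs_nonneg (v.trdCoord : ℝ)) r
  unfold denom; linarith

theorem trd_le_denom (v : LexZ3) : |(v.trdCoord : ℝ)| ^ r + 1 ≤ denom r v := by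
  have h2 := Real.rpow_nonneg (abs_nonneg (v.fstCoord : ℝ)) 8
  have h3 := Real.rpow_nonneg (abs_nonneg (v.sndCoord : ℝ)) 8
  unfold denom; linarith

theorem summable_lexWeight (hr : 4 / 3 < r) : Summable (lexWeight 8 8 r) := by
  have hr0 : 0 < r := by linarith
  have hinv : 1 / r < 3 / 4 := by rw [div_lt_div_iff₀ hr0 (by norm_num)]; linarith
  have hinv0 : 0 < 1 / r := by positivity
  -- The slack `1 - (1/8 + 1/8 + 1/r)` is cut into four equal parts: the exponents `1/8 + η`, `1/8 +
  -- η`, `1/r + 2η` add up to `1`, and each gives a convergent series in its own coordinate.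
  set η := (3 / 4 - 1 / r) / 4 with hη
  have h1 : 1 < 8 * (1 / 8 + η) := by linarith
  have h3 : 1 < r * (1 / r + 2 * η) := by
    have : r * (1 / r + 2 * η) = 1 + r * (2 * η) := by field_simp
    rw [this]
    have : 0 < r * (2 * η) := mul_pos hr0 (by linarith)
    linarith
  have hs := (summable_half _ h1).mul_of_nonneg ((summable_half _ h1).mul_of_nonneg
    (summable_half _ h3) (fun _ => by positivity) (fun _ => by positivity))
    (fun _ => by positivity) (fun _ => by dsimp only [Pi.zero_apply]; positivity)
  have hs' : Summable fun v : LexZ3 => 1 / |(v.fstCoord : ℝ) + 1 / 2| ^ (8 * (1 / 8 + η)) *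
      (1 / |(v.sndCoord : ℝ) + 1 / 2| ^ (8 * (1 / 8 + η)) *
      (1 / |(v.trdCoord : ℝ) + 1 / 2| ^ (r * (1 / r + 2 * η)))) := hs
  refine Summable.of_nonneg_of_le (fun v => ?_) (fun v => ?_) (hs'.mul_left
    ((2 ^ (8 : ℝ)) ^ (1 / 8 + η) * ((2 ^ (8 : ℝ)) ^ (1 / 8 + η) * (2 ^ r) ^ (1 / r + 2 * η))))
  · rw [lexWeight_eq]; exact one_div_nonneg.2 (denom_pos v).le
  · have hX := denom_pos (r := r) v
    have i1 := rpow_neg_le_of_le (p := 8) (t := 1 / 8 + η) (by norm_num) (by linarith) hX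
      (fst_le_denom v)
    have i2 := rpow_neg_le_of_le (p := 8) (t := 1 / 8 + η) (by norm_num) (by linarith) hX
      (snd_le_denom v)
    have i3 := rpow_neg_le_of_le (t := 1 / r + 2 * η) hr0 (by linarith) hX (trd_le_denom v)
    have e : lexWeight 8 8 r v = denom r v ^ (-(1 / 8 + η)) * (denom r v ^ (-(1 / 8 + η)) *
        denom r v ^ (-(1 / r + 2 * η))) := by
      rw [lexWeight_eq, ← Real.rpow_add hX, ← Real.rpow_add hX, one_div, ← Real.rpow_neg_one]
      congr 1
      rw [hη]; ring
    rw [e]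
    refine (mul_le_mul i1 (mul_le_mul i2 i3 (by positivity) (by positivity)) (by positivity)
      (by positivity)).trans (le_of_eq ?_)
    ring

/-- Discarding the `i`- and `j`-terms of `denom` makes the bound uniform over all lines. -/
theorem summable_line {t : ℝ} (hr : 0 < r) (ht : 1 < r * t) : ∃ C : ℝ, ∀ (i j : ℤ)
    (s : Finset ℤ), ∑ k ∈ s, denom r (mk i j k) ^ (-t) ≤ C := by
  have ht0 : 0 < t := pos_of_mul_pos_right (one_pos.trans ht) hr.le
  refine ⟨(2 ^ r) ^ t * ∑' k : ℤ, 1 / |(k : ℝ) + 1 / 2| ^ (r * t), fun i j s => ?_⟩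
  calc _ ≤ ∑ k ∈ s, (2 ^ r) ^ t * (1 / |(k : ℝ) + 1 / 2| ^ (r * t)) :=
        Finset.sum_le_sum fun k _ => rpow_neg_le_of_le hr ht0 (denom_pos _)
          (trd_le_denom (mk i j k))
    _ ≤ _ := by
        rw [← Finset.mul_sum]
        gcongr
        exact (summable_half _ ht).sum_le_tsum _ fun _ _ => by positivity

open Filter Topology in
theorem tendsto_denom_shift (hr : 1 < r) (v : LexZ3) :
    Tendsto (fun n : ℤ => denom r (v.shift n)) cofinite atTop := by
  have h1 : Tendsto (fun n : ℤ => |((v.trdCoord + n : ℤ) : ℝ)| ^ r) cofinite atTop := by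
    refine (tendsto_rpow_atTop (by linarith)).comp ?_
    have h2 : Tendsto (fun n : ℤ => v.trdCoord + n) cofinite cofinite :=
      (add_right_injective v.trdCoord).tendsto_cofinite
    have h3 : Tendsto (fun n : ℤ => ((n : ℤ) : ℝ)) cofinite (cocompact ℝ) :=
      Int.tendsto_coe_cofinite
    exact (tendsto_norm_cocompact_atTop.comp h3).comp h2
  refine tendsto_atTop_mono (fun n => ?_) h1
  have := trd_le_denom (r := r) (v.shift n)
  rw [trdCoord_shift] at this
  linarith

open Filter Topology in
-- The relative change of `denom` under `g` is `O(denom ^ (-1/8))`, and `denom` tends to infinity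
-- along a line.
theorem tendsto_denom_div (hr : 1 < r) (hr2 : 1 / r ≥ 3 / 8) (g : N4) (v : LexZ3) :
    Tendsto (fun n : ℤ => denom r (v.shift n) / denom r (act g (v.shift n))) cofinite (𝓝 1) := by
  obtain ⟨C, hC, h⟩ := denom_act_sub hr hr2 g
  have hinv : Tendsto (fun n : ℤ => denom r (act g (v.shift n)) / denom r (v.shift n))
      cofinite (𝓝 1) := by
    rw [tendsto_iff_norm_sub_tendsto_zero]
    have h0 : Tendsto (fun n : ℤ => C * denom r (v.shift n) ^ (-(1 / 8 : ℝ))) cofinite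
        (𝓝 (C * 0)) :=
      ((tendsto_rpow_neg_atTop (by norm_num)).comp (tendsto_denom_shift hr v)).const_mul C
    rw [mul_zero] at h0
    refine squeeze_zero (fun _ => norm_nonneg _) (fun n => ?_) h0
    have hp := denom_pos (r := r) (v.shift n)
    rw [Real.norm_eq_abs, div_sub_one hp.ne', abs_div, abs_of_pos hp, div_le_iff₀ hp, mul_assoc,
      ← Real.rpow_add_one hp.ne']
    rw [show (-(1 / 8) + 1 : ℝ) = 7 / 8 by norm_num]
    exact h (v.shift n)
  simpa using hinv.inv₀ one_ne_zero

/-- The displacement of `k` is a combination of `1`, `i`, `j`, `i j`; the four points with `i, j ∈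
{0, 1}` determine its coefficients. -/
theorem act_injective {g : N4} (h : ∀ v, act g v = v) : g = 1 := by
  have h0 := h (mk 0 0 0)
  have h1 := h (mk 1 0 0)
  have h2 := h (mk 0 1 0)
  have h3 := h (mk 1 1 0)
  have a0 := congrArg fstCoord h0
  have a1 := congrArg sndCoord h0
  have a2 := congrArg trdCoord h0
  have a3 := congrArg trdCoord h1
  have a4 := congrArg trdCoord h2
  have a5 := congrArg trdCoord h3
  obtain ⟨A, hA, hA'⟩ := g
  simp only [act, fstCoord_mk, sndCoord_mk, trdCoord_mk] at a0 a1 a2 a3 a4 a5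
  have e10 : A 1 0 = 0 := by linarith
  have e32 : A 3 2 = 0 := by linarith
  rw [e32] at a2 a3 a4 a5
  have e30 : A 3 0 = 0 := by linarith
  have e31 : A 3 1 = 0 := by linarith
  have e20 : A 2 0 = 0 := by linarith
  have e21 : A 2 1 = 0 := by linarith
  have a01 := hA' 0 1 (by decide)
  have a02 := hA' 0 2 (by decide)
  have a03 := hA' 0 3 (by decide)
  have a12 := hA' 1 2 (by decide)
  have a13 := hA' 1 3 (by decide)
  have a23 := hA' 2 3 (by decide)
  have d0 := hA 0
  have d1 := hA 1
  have d2 := hA 2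
  have d3 := hA 3
  apply Subtype.ext
  apply Subtype.ext
  change (A : Matrix (Fin 4) (Fin 4) ℤ) = 1
  clear h h0 h1 h2 h3 a0 a1 a2 a3 a4 a5
  ext i j
  fin_cases i <;> fin_cases j <;> simp_all

end LexZ3
end

noncomputable section

/-! ### Construction of the intervals -/

namespace LexZ3

theorem lt_shift_one (u v : LexZ3) : u < v.shift 1 ↔ u < v ∨ u = v := by
  have e : u = v ↔ u.fstCoord = v.fstCoord ∧ u.sndCoord = v.sndCoord ∧
      u.trdCoord = v.trdCoord :=
    ⟨fun h => by subst h; simp, fun h => ext_coord h.1 h.2.1 h.2.2⟩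
  rw [lt_iff, lt_iff, e, fstCoord_shift, sndCoord_shift, trdCoord_shift]
  omega

theorem shift_one_le {u v : LexZ3} (h : u < v) : u.shift 1 ≤ v := by
  by_contra! h'
  rcases (lt_shift_one _ _).1 h' with h1 | h1
  · exact lt_asymm h h1
  · exact h.ne' h1

instance : Countable LexZ3 := inferInstanceAs (Countable (ℤ × ℤ × ℤ))

end LexZ3

open MeasureTheory Set

/-- The interval `[left v, left (v + 1))` of a family of intervals indexed by `ℤ³`. -/
def lexCell (left : LexZ3 → ℝ) (v : LexZ3) : Set ℝ := Ico (left v) (left (v.shift 1))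

theorem lexCell_disjoint {left : LexZ3 → ℝ} (h : StrictMono left) :
    Pairwise (Function.onFun Disjoint (lexCell left)) := by
  have aux : ∀ u v : LexZ3, u < v → Disjoint (lexCell left u) (lexCell left v) := by
    intro u v huv
    refine disjoint_left.2 fun x hx hx' => ?_
    exact absurd (hx.2.trans_le (h.monotone (LexZ3.shift_one_le huv))) hx'.1.not_gt
  intro u v huv
  rcases lt_or_gt_of_ne huv with h | h
  · exact aux u v h
  · exact (aux v u h).symm

/-- `left v` is the sum of the lengths `ℓ u`, `u < v`, and the total length is `1`. -/
structure IsCumulative (left ℓ : LexZ3 → ℝ) : Prop where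
  pos : ∀ v, 0 < ℓ v
  hasSum_one : HasSum ℓ 1
  hasSum_left : ∀ v, HasSum ((Iio v).indicator ℓ) (left v)

namespace IsCumulative

variable {left ℓ : LexZ3 → ℝ} (h : IsCumulative left ℓ)

include h

theorem left_shift_one (v : LexZ3) : left (v.shift 1) = left v + ℓ v := by
  refine (h.hasSum_left _).unique ?_
  have h1 : HasSum (fun u => if u = v then ℓ v else 0) (ℓ v) := hasSum_ite_eq v (ℓ v)
  convert (h.hasSum_left v).add h1 using 1
  ext u
  simp only [indicator, mem_Iio, LexZ3.lt_shift_one]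
  by_cases h1 : u < v
  · simp [h1, h1.ne]
  · by_cases h2 : u = v
    · simp [h2]
    · simp [h1, h2]

theorem monotone : Monotone left := fun u v huv => by
  refine hasSum_le (fun w => ?_) (h.hasSum_left u) (h.hasSum_left v)
  exact indicator_le_indicator_of_subset (Iio_subset_Iio huv) (fun w => (h.pos w).le) w

theorem strictMono : StrictMono left := fun u v huv => by
  have := h.monotone (LexZ3.shift_one_le huv)
  rw [h.left_shift_one] at this
  linarith [h.pos u]

theorem mem (v : LexZ3) : left v ∈ Icc (0 : ℝ) 1 :=
  ⟨(h.hasSum_left v).nonneg fun w => indicator_nonneg (fun w _ => (h.pos w).le) w,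
    hasSum_le (fun w => indicator_le_self' (fun w _ => (h.pos w).le) w)
      (h.hasSum_left v) h.hasSum_one⟩

theorem lexCell_subset_Ico_one (v : LexZ3) : lexCell left v ⊆ Ico 0 1 := fun _ hx =>
  ⟨(h.mem v).1.trans hx.1, hx.2.trans_le (h.mem _).2⟩

/-- Disjoint cells of total length `t` inside `[0, t)` leave only a null set. The case `A = univ`
gives density and the value of `cellMap` at `1`; the case `A = Iio v` gives its value at `left v`.
-/
theorem iUnion_lexCell_ae_eq {A : Set LexZ3} {t : ℝ} (hA : HasSum (A.indicator ℓ) t)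
    (hsub : ∀ u ∈ A, lexCell left u ⊆ Ico 0 t) :
    (⋃ u : A, lexCell left u) =ᵐ[volume] Ico 0 t := by
  refine ae_eq_of_subset_of_measure_ge (iUnion_subset fun u => hsub u u.2) ?_
    (MeasurableSet.iUnion fun _ => measurableSet_Ico).nullMeasurableSet (by simp)
  rw [measure_iUnion (f := fun u : A => lexCell left u) (fun u v huv => lexCell_disjoint h.strictMono
    (fun e => huv (Subtype.ext e))) fun _ => measurableSet_Ico]
  have e : ∀ u : A, volume (lexCell left u) = ENNReal.ofReal (ℓ u) := fun u => by
    rw [lexCell, Real.volume_Ico, h.left_shift_one, add_sub_cancel_left]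
  have hA' : HasSum (fun u : A => ℓ u) t := hasSum_subtype_iff_indicator.2 hA
  simp_rw [e]
  rw [← ENNReal.ofReal_tsum_of_nonneg (fun u : A => (h.pos u).le) hA'.summable, hA'.tsum_eq,
    Real.volume_Ico, sub_zero]

theorem dense {x : ℝ} (hx : x ∈ Icc (0 : ℝ) 1) {ε : ℝ} (hε : 0 < ε) :
    ∃ v, ∃ y ∈ lexCell left v, |y - x| < ε := by
  by_contra! hcon
  have h1 := h.iUnion_lexCell_ae_eq (A := univ) (t := 1) (by simpa using h.hasSum_one)
    (fun u _ => h.lexCell_subset_Ico_one u)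
  have hempty : volume (Ico 0 1 ∩ Ioo (x - ε) (x + ε)) = 0 := by
    refine measure_mono_null (fun y hy => ?_) (ae_eq_set.1 h1).2
    refine ⟨hy.1, fun hy' => ?_⟩
    obtain ⟨v, hv⟩ := mem_iUnion.1 hy'
    have := hcon v y hv
    rw [le_abs] at this
    rcases this with h | h <;> linarith [hy.2.1, hy.2.2]
  have hsub : Ioo (max 0 (x - ε)) (min 1 (x + ε)) ⊆ Ico 0 1 ∩ Ioo (x - ε) (x + ε) := by
    intro y hy
    have h1 := (max_lt_iff.1 hy.1)
    have h2 := (lt_min_iff.1 hy.2)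
    exact ⟨⟨h1.1.le, h2.1⟩, h1.2, h2.2⟩
  have h0 := measure_mono_null hsub hempty
  rw [Real.volume_Ioo, ENNReal.ofReal_eq_zero, sub_nonpos, min_le_iff, le_max_iff,
    le_max_iff] at h0
  rcases h0 with (h0 | h0) | (h0 | h0) <;> linarith [hx.1, hx.2]

/-- The family of intervals with prescribed lengths. -/
def toLexIntervals : LexIntervals where
  left := left
  strictMono := h.strictMono
  mem := h.mem
  dense := by
    intro x hx
    refine Metric.mem_closure_iff.2 fun ε hε => ?_
    obtain ⟨v, y, hy, hyx⟩ := h.dense hx (half_pos hε)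
    have hlt : y < min (left (v.shift 1)) (y + ε / 2) := lt_min hy.2 (by linarith)
    obtain ⟨z, hz1, hz2⟩ := exists_between hlt
    refine ⟨z, mem_iUnion.2 ⟨v, hy.1.trans_lt hz1, hz2.trans_le (min_le_left _ _)⟩, ?_⟩
    have h3 := hz2.trans_le (min_le_right _ _)
    rw [dist_comm, Real.dist_eq]
    rw [abs_lt] at hyx ⊢
    constructor <;> linarith [hyx.1, hyx.2]

end IsCumulative

theorem exists_isCumulative {ℓ : LexZ3 → ℝ} (hpos : ∀ v, 0 < ℓ v) (hsum : HasSum ℓ 1) :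
    IsCumulative (fun v => ∑' u, (Iio v).indicator ℓ u) ℓ where
  pos := hpos
  hasSum_one := hsum
  hasSum_left v := (hsum.summable.indicator (Iio v)).hasSum

end

noncomputable section

/-! ### A criterion for Hölder continuity -/

open Set Filter Topology

/-- The hypotheses of the Hölder criterion: `F` is `α`-Hölder on each cell with a constant `b v`,
the `1 / (1 - α)`-th powers of these constants have bounded sums along the lines `(i, j, *)`, and
`F` is `1` outside of the cells and at the ends of the lines. -/
structure CellwiseHolder (left : LexZ3 → ℝ) (F : ℝ → ℝ) (b : LexZ3 → ℝ) (α K : ℝ) : Prop where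
  strictMono : StrictMono left
  pos : 0 < α
  lt_one : α < 1
  eq_one : ∀ x, (∀ v, x ∉ lexCell left v) → F x = 1
  nonneg : ∀ v, 0 ≤ b v
  cell : ∀ v, ∀ x ∈ Icc (left v) (left (v.shift 1)), ∀ y ∈ Icc (left v) (left (v.shift 1)),
    |F x - F y| ≤ b v * |x - y| ^ α
  sum_le : ∀ (v : LexZ3) (n : ℕ), ∑ k ∈ Finset.range n, b (v.shift k) ^ (1 / (1 - α)) ≤ K
  tendsto_top : ∀ v : LexZ3, Tendsto (fun n : ℕ => F (left (v.shift n))) atTop (𝓝 1)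
  tendsto_bot : ∀ v : LexZ3, Tendsto (fun n : ℕ => F (left (v.shift (-n)))) atTop (𝓝 1)

namespace CellwiseHolder

variable {left : LexZ3 → ℝ} {F : ℝ → ℝ} {b : LexZ3 → ℝ} {α K : ℝ}
  (h : CellwiseHolder left F b α K)

include h

theorem const_nonneg : 0 ≤ K := by simpa using h.sum_le (LexZ3.mk 0 0 0) 0

theorem bound_nonneg : 0 ≤ K ^ (1 - α) := Real.rpow_nonneg h.const_nonneg _

theorem left_lt_shift (v : LexZ3) : left v < left (v.shift 1) := by
  have := v.shift_lt_shift (zero_lt_one' ℤ)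
  rw [LexZ3.shift_zero] at this
  exact h.strictMono this

theorem b_le (v : LexZ3) : b v ≤ K ^ (1 - α) := by
  have h1 := h.sum_le v 1
  have h0 : 0 < 1 - α := sub_pos.2 h.lt_one
  simp only [Finset.range_one, Finset.sum_singleton, Nat.cast_zero, LexZ3.shift_zero] at h1
  have h2 := Real.rpow_le_rpow (Real.rpow_nonneg (h.nonneg v) _) h1 h0.le
  rwa [← Real.rpow_mul (h.nonneg v), one_div_mul_cancel h0.ne', Real.rpow_one] at h2

/-- Telescoping over the cells between the endpoints, followed by Hölder's inequality for `∑ b *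
length ^ α` with exponents `1 / (1 - α)` and `1 / α`. -/
theorem endpoints (v : LexZ3) (n : ℕ) : |F (left (v.shift n)) - F (left v)|
    ≤ K ^ (1 - α) * (left (v.shift n) - left v) ^ α := by
  have h0 : 0 < 1 - α := sub_pos.2 h.lt_one
  have hα := h.pos
  have hpq : (1 / (1 - α)).HolderConjugate (1 / α) := by
    rw [Real.holderConjugate_iff]
    refine ⟨by rw [lt_div_iff₀ h0]; linarith, by simp⟩
  have hlen : ∀ k : ℕ, 0 ≤ left (v.shift (k + 1 : ℕ)) - left (v.shift k) := fun k =>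
    sub_nonneg.2 (h.strictMono.monotone (v.shift_lt_shift (by push_cast; linarith)).le)
  have e1 : F (left (v.shift n)) - F (left v) = ∑ k ∈ Finset.range n,
      (F (left (v.shift (k + 1 : ℕ))) - F (left (v.shift k))) := by
    rw [Finset.sum_range_sub (fun k : ℕ => F (left (v.shift k)))]
    simp
  have e2 : left (v.shift n) - left v = ∑ k ∈ Finset.range n,
      (left (v.shift (k + 1 : ℕ)) - left (v.shift k)) := by
    rw [Finset.sum_range_sub (fun k : ℕ => left (v.shift k))]
    simp
  have hstep : ∀ k : ℕ, |F (left (v.shift (k + 1 : ℕ))) - F (left (v.shift k))| ≤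
      b (v.shift k) * (left (v.shift (k + 1 : ℕ)) - left (v.shift k)) ^ α := fun k => by
    have e : v.shift (k + 1 : ℕ) = (v.shift k).shift 1 := by
      rw [LexZ3.shift_shift]; push_cast; rfl
    have hl := (h.left_lt_shift (v.shift k)).le
    have := h.cell (v.shift k) _ (right_mem_Icc.2 hl) _ (left_mem_Icc.2 hl)
    rwa [← e, abs_of_nonneg (hlen k)] at this
  have hH := Real.inner_le_Lp_mul_Lq_of_nonneg (Finset.range n) hpq
    (f := fun k : ℕ => b (v.shift k))
    (g := fun k : ℕ => (left (v.shift (k + 1 : ℕ)) - left (v.shift k)) ^ α)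
    (fun k _ => h.nonneg _) (fun k _ => Real.rpow_nonneg (hlen k) _)
  have e3 : ∀ k : ℕ, ((left (v.shift (k + 1 : ℕ)) - left (v.shift k)) ^ α) ^ (1 / α)
      = left (v.shift (k + 1 : ℕ)) - left (v.shift k) := fun k => by
    rw [← Real.rpow_mul (hlen k), mul_one_div_cancel hα.ne', Real.rpow_one]
  simp only [e3, one_div_one_div, ← e2] at hH
  rw [e1]
  refine (Finset.abs_sum_le_sum_abs _ _).trans ((Finset.sum_le_sum fun k _ => hstep k).trans
    (hH.trans ?_))
  refine mul_le_mul_of_nonneg_right (Real.rpow_le_rpow (Finset.sum_nonneg fun k _ =>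
    Real.rpow_nonneg (h.nonneg _) _) (h.sum_le v n) h0.le) (Real.rpow_nonneg ?_ _)
  rw [e2]
  exact Finset.sum_nonneg fun k _ => hlen k

/-- The path from `x` to `y` is cut at the first endpoint after `x` and the last one before `y`;
each of the three pieces costs one constant. -/
theorem same_line {v : LexZ3} {n : ℕ} {x y : ℝ} (hx : x ∈ lexCell left v)
    (hy : y ∈ lexCell left (v.shift n)) (hxy : x ≤ y) :
    |F x - F y| ≤ 3 * K ^ (1 - α) * (y - x) ^ α := by
  have hK := h.bound_nonneg
  have hα := h.pos
  rcases n with _ | n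
  · simp only [Nat.cast_zero, LexZ3.shift_zero] at hy
    have h1 := h.cell v x ⟨hx.1, hx.2.le⟩ y ⟨hy.1, hy.2.le⟩
    rw [abs_sub_comm x, abs_of_nonneg (sub_nonneg.2 hxy)] at h1
    have h2 := mul_le_mul_of_nonneg_right (h.b_le v)
      (Real.rpow_nonneg (sub_nonneg.2 hxy) α)
    have h3 := mul_nonneg hK (Real.rpow_nonneg (sub_nonneg.2 hxy) α)
    linarith
  · have e : v.shift (n + 1 : ℕ) = (v.shift 1).shift n := by
      rw [LexZ3.shift_shift]; push_cast; rw [add_comm]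
    rw [e] at hy
    set u := v.shift 1
    have hu : left u ≤ left (u.shift n) := by
      have : u.shift 0 ≤ u.shift n := by
        rcases Nat.eq_zero_or_pos n with rfl | hn
        · exact le_rfl
        · exact (u.shift_lt_shift (by exact_mod_cast hn)).le
      rw [LexZ3.shift_zero] at this
      exact h.strictMono.monotone this
    have i1 := h.cell v x ⟨hx.1, hx.2.le⟩ (left u) ⟨(h.left_lt_shift v).le, le_rfl⟩
    have i2 := h.endpoints u n
    have i3 := h.cell (u.shift n) (left (u.shift n)) ⟨le_rfl, (h.left_lt_shift _).le⟩ y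
      ⟨hy.1, hy.2.le⟩
    rw [abs_sub_comm x, abs_of_nonneg (sub_nonneg.2 hx.2.le)] at i1
    rw [abs_sub_comm _ y, abs_of_nonneg (sub_nonneg.2 hy.1)] at i3
    have hxu : x ≤ left u := hx.2.le
    have hyu : left (u.shift n) ≤ y := hy.1
    have j1 : (left u - x) ^ α ≤ (y - x) ^ α :=
      Real.rpow_le_rpow (by linarith) (by linarith) hα.le
    have j2 : (left (u.shift n) - left u) ^ α ≤ (y - x) ^ α :=
      Real.rpow_le_rpow (by linarith) (by linarith) hα.le
    have j3 : (y - left (u.shift n)) ^ α ≤ (y - x) ^ α :=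
      Real.rpow_le_rpow (by linarith) (by linarith) hα.le
    have k1 := i1.trans (mul_le_mul (h.b_le v) j1 (Real.rpow_nonneg (by linarith) _) hK)
    have k2 := i2.trans (mul_le_mul_of_nonneg_left j2 hK)
    have k3 := i3.trans (mul_le_mul (h.b_le _) j3 (Real.rpow_nonneg (by linarith) _) hK)
    have e2 : F x - F y = (F x - F (left u)) - (F (left (u.shift n)) - F (left u))
      + (F (left (u.shift n)) - F y) := by ring
    rw [e2]
    refine (abs_add_le _ _).trans ?_
    have := abs_sub (F x - F (left u)) (F (left (u.shift n)) - F (left u))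
    linarith

theorem left_mem_lexCell (v : LexZ3) : left v ∈ lexCell left v := ⟨le_rfl, h.left_lt_shift v⟩

/-- Here `z` lies beyond the whole line of `x`: compare `x` with endpoints further and further along
that line, where `F` tends to `1`, and pass to the limit. -/
theorem sub_one_le_of_right {v : LexZ3} {x z : ℝ} (hx : x ∈ lexCell left v)
    (hz : ∀ n : ℕ, left (v.shift n) ≤ z) : |F x - 1| ≤ 3 * K ^ (1 - α) * (z - x) ^ α := by
  have hK := h.bound_nonneg
  refine le_of_tendsto ((tendsto_const_nhds.sub (h.tendsto_top v)).abs) ?_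
  filter_upwards [eventually_ge_atTop 1] with n hn
  have hxn : x ≤ left (v.shift n) :=
    hx.2.le.trans (h.strictMono.monotone
      (LexZ3.shift_one_le (by simpa using v.shift_lt_shift (m := 0) (n := n) (by omega))))
  refine (h.same_line hx (h.left_mem_lexCell _) hxn).trans ?_
  have : (left (v.shift n) - x) ^ α ≤ (z - x) ^ α :=
    Real.rpow_le_rpow (by linarith) (by linarith [hz n]) h.pos.le
  gcongr

theorem sub_one_le_of_left {v : LexZ3} {y z : ℝ} (hy : y ∈ lexCell left v)
    (hz : ∀ n : ℕ, z ≤ left (v.shift (-n))) : |F y - 1| ≤ 3 * K ^ (1 - α) * (y - z) ^ α := by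
  have hK := h.bound_nonneg
  refine le_of_tendsto ((tendsto_const_nhds.sub (h.tendsto_bot v)).abs) ?_
  filter_upwards with n
  have hyn : left (v.shift (-n)) ≤ y := by
    refine le_trans (h.strictMono.monotone ?_) hy.1
    rcases Nat.eq_zero_or_pos n with rfl | hn
    · simp
    · simpa using (v.shift_lt_shift (m := -n) (n := 0) (by omega)).le
  have h1 := h.same_line (n := n) (h.left_mem_lexCell (v.shift (-n))) (by simpa using hy) hyn
  rw [abs_sub_comm]
  refine h1.trans ?_
  have : (y - left (v.shift (-n))) ^ α ≤ (y - z) ^ α :=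
    Real.rpow_le_rpow (by linarith) (by linarith [hz n]) h.pos.le
  gcongr

/-- If no single line contains both points, then `y` is beyond the line of `x` and `x` before that
of `y`, so both values are compared with `1`, whence `6 = 3 + 3`. A point in no cell has value `1`
already. -/
theorem holder_of_lt {x y : ℝ} (hxy : x < y) :
    |F x - F y| ≤ 6 * K ^ (1 - α) * (y - x) ^ α := by
  have hK := h.bound_nonneg
  have hp : 0 ≤ K ^ (1 - α) * (y - x) ^ α :=
    mul_nonneg hK (Real.rpow_nonneg (sub_nonneg.2 hxy.le) _)
  by_cases hline : ∃ (v : LexZ3) (n : ℕ), x ∈ lexCell left v ∧ y ∈ lexCell left (v.shift n)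
  · obtain ⟨v, n, hx, hy⟩ := hline
    linarith [h.same_line hx hy hxy.le]
  push Not at hline
  have h1 : |F x - 1| ≤ 3 * K ^ (1 - α) * (y - x) ^ α := by
    by_cases hx : ∃ v, x ∈ lexCell left v
    · obtain ⟨v, hv⟩ := hx
      refine h.sub_one_le_of_right hv fun n => ?_
      -- Should the endpoints of the line pass `y`, the first to do so would place `y` in a cell of
      -- the line of `x`.
      induction n with
      | zero => simpa using hv.1.trans hxy.le
      | succ n ih =>
        by_contra! hlt
        refine hline v n hv ⟨ih, ?_⟩
        rw [LexZ3.shift_shift]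
        exact_mod_cast hlt
    · rw [h.eq_one x (by simpa using hx), sub_self, abs_zero]
      linarith
  have h2 : |F y - 1| ≤ 3 * K ^ (1 - α) * (y - x) ^ α := by
    by_cases hy : ∃ v, y ∈ lexCell left v
    · obtain ⟨v, hv⟩ := hy
      have hnot : ∀ n : ℕ, x ∉ lexCell left (v.shift (-n)) := fun n hx =>
        hline _ n hx (by simpa using hv)
      refine h.sub_one_le_of_left hv fun n => le_of_lt ?_
      induction n with
      | zero =>
        by_contra! hlt
        refine hnot 0 ⟨hlt, ?_⟩
        simpa using hxy.trans hv.2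
      | succ n ih =>
        by_contra! hlt
        refine hnot (n + 1) ⟨hlt, ?_⟩
        rw [LexZ3.shift_shift]
        push_cast
        rwa [neg_add, neg_add_cancel_right]
    · rw [h.eq_one y (by simpa using hy), sub_self, abs_zero]
      linarith
  rw [show F x - F y = (F x - 1) - (F y - 1) by ring]
  linarith [abs_sub (F x - 1) (F y - 1)]

theorem holder (x y : ℝ) : |F x - F y| ≤ 6 * K ^ (1 - α) * |x - y| ^ α := by
  rcases lt_trichotomy x y with hxy | rfl | hxy
  · rw [abs_sub_comm x, abs_of_pos (sub_pos.2 hxy)]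
    exact h.holder_of_lt hxy
  · simp [Real.zero_rpow h.pos.ne']
  · rw [abs_sub_comm, abs_of_pos (sub_pos.2 hxy)]
    exact h.holder_of_lt hxy

end CellwiseHolder

theorem continuous_of_abs_sub_le {F : ℝ → ℝ} {C α : ℝ} (hα : 0 < α)
    (h : ∀ x y, |F x - F y| ≤ C * |x - y| ^ α) : Continuous F := by
  refine continuous_iff_continuousAt.2 fun x => ?_
  rw [ContinuousAt, tendsto_iff_norm_sub_tendsto_zero]
  have h0 : Tendsto (fun y => C * |y - x| ^ α) (𝓝 x) (𝓝 (C * |x - x| ^ α)) := by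
    refine ((((continuous_id.sub continuous_const).abs.rpow_const
      fun _ => Or.inr hα.le).const_mul C).tendsto x)
  rw [sub_self, abs_zero, Real.zero_rpow hα.ne', mul_zero] at h0
  exact squeeze_zero (fun _ => norm_nonneg _) (fun y => h y x) h0

end

noncomputable section

/-! ### The derivatives of the diffeomorphisms -/

open Set Filter Topology MeasureTheory

/-- The intervals `S` have lengths `lexWeight 8 8 r v / L`, with `4 / 3 < r ≤ 3 / 2`. -/
structure IsWeightedFamily (S : LexIntervals) (r L : ℝ) : Prop where
  lt_r : 4 / 3 < r
  r_le : r ≤ 3 / 2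
  L_pos : 0 < L
  cumulative : IsCumulative S.left fun v => lexWeight 8 8 r v / L

/-- The derivative of the map induced by `g` on the intervals `I_v`, and `1` elsewhere. -/
def cellDeriv (S : LexIntervals) (g : N4) (x : ℝ) : ℝ :=
  open Classical in
  if hx : ∃ v, x ∈ lexCell S.left v then
    PixtonTsuboi.dmap (S.pair hx.choose) (S.pair (LexZ3.act g hx.choose)) x else 1

section

variable {S : LexIntervals} (g : N4) {v : LexZ3} {x : ℝ}

theorem LexIntervals.pair_main (S : LexIntervals) (v : LexZ3) :
    (S.pair v).main = Icc (S.left v) (S.left (v.shift 1)) := by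
  simp only [ContigPair.main, LexIntervals.pair, LexZ3.shift_zero]

theorem LexIntervals.pair_b (S : LexIntervals) (v : LexZ3) : (S.pair v).b = S.left v := by
  simp only [LexIntervals.pair, LexZ3.shift_zero]

theorem LexIntervals.pair_c (S : LexIntervals) (v : LexZ3) :
    (S.pair v).c = S.left (v.shift 1) := rfl

theorem LexIntervals.lenLeft_pair (S : LexIntervals) (v : LexZ3) :
    (S.pair v).lenLeft = (S.pair (v.shift (-1))).len := by
  simp [ContigPair.lenLeft, ContigPair.len, LexIntervals.pair]

theorem cellDeriv_of_mem (hx : x ∈ lexCell S.left v) :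
    cellDeriv S g x = PixtonTsuboi.dmap (S.pair v) (S.pair (LexZ3.act g v)) x := by
  have hex : ∃ v, x ∈ lexCell S.left v := ⟨v, hx⟩
  have he : hex.choose = v := by
    by_contra hne
    exact disjoint_left.1 (lexCell_disjoint S.strictMono hne) hex.choose_spec hx
  rw [cellDeriv, dif_pos hex, he]

theorem cellDeriv_of_forall_notMem (hx : ∀ v, x ∉ lexCell S.left v) : cellDeriv S g x = 1 := by
  rw [cellDeriv, dif_neg (by simpa using hx)]

theorem left_mem_lexCell (S : LexIntervals) (v : LexZ3) : S.left v ∈ lexCell S.left v :=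
  ⟨le_rfl, S.strictMono (by simpa using v.shift_lt_shift one_pos)⟩

theorem cellDeriv_left (v : LexZ3) : cellDeriv S g (S.left v) =
    (S.pair (LexZ3.act g (v.shift (-1)))).len / (S.pair (v.shift (-1))).len := by
  rw [cellDeriv_of_mem g (left_mem_lexCell S v), ← S.pair_b v, PixtonTsuboi.dmap_b,
    S.lenLeft_pair, S.lenLeft_pair, LexZ3.act_shift]

/-- The right endpoint belongs to the next cell; there the right slope of one map is the left slope
of the next, which is the purpose of the two endpoint conditions on the family. -/
theorem cellDeriv_of_mem_main (hx : x ∈ (S.pair v).main) :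
    cellDeriv S g x = PixtonTsuboi.dmap (S.pair v) (S.pair (LexZ3.act g v)) x := by
  rcases eq_or_ne x (S.left (v.shift 1)) with rfl | hne
  · rw [cellDeriv_left, ← S.pair_c v, PixtonTsuboi.dmap_c]
    simp
  · rw [S.pair_main] at hx
    exact cellDeriv_of_mem g ⟨hx.1, hx.2.lt_of_ne hne⟩

theorem cellDeriv_pos (x : ℝ) : 0 < cellDeriv S g x := by
  by_cases hx : ∃ v, x ∈ lexCell S.left v
  · obtain ⟨v, hv⟩ := hx
    rw [cellDeriv_of_mem g hv]
    exact PixtonTsuboi.dmap_pos (by rw [S.pair_main]; exact ⟨hv.1, hv.2.le⟩)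
  · rw [cellDeriv_of_forall_notMem g (by simpa using hx)]
    exact one_pos

end

namespace IsWeightedFamily

variable {S : LexIntervals} {r L : ℝ} (h : IsWeightedFamily S r L)

open LexZ3

include h

theorem r_pos : 0 < r := by linarith [h.lt_r]

theorem one_lt_r : 1 < r := by linarith [h.lt_r]

theorem inv_r : 1 / r ≥ 3 / 8 := by
  rw [ge_iff_le, div_le_div_iff₀ (by norm_num) h.r_pos]; linarith [h.r_le]

theorem len_eq (v : LexZ3) : (S.pair v).len = 1 / (denom r v * L) := by
  have := h.cumulative.left_shift_one v
  rw [ContigPair.len, S.pair_b, S.pair_c, this, add_sub_cancel_left, lexWeight_eq, div_div]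

theorem len_div (v w : LexZ3) : (S.pair v).len / (S.pair w).len = denom r w / denom r v := by
  have h1 := (denom_pos (r := r) v).ne'
  have h2 := (denom_pos (r := r) w).ne'
  have h3 := h.L_pos.ne'
  rw [h.len_eq, h.len_eq]
  field_simp

theorem ratio_eq (v : LexZ3) :
    (S.pair v).ratio = denom r v / denom r (v.shift (-1)) := by
  rw [ContigPair.ratio, S.lenLeft_pair, h.len_div]

theorem exists_ratio_bound : ∃ κ : ℝ, 0 < κ ∧ κ ≤ 1 ∧
    ∀ v, κ ≤ (S.pair v).ratio ∧ (S.pair v).ratio ≤ 1 / κ := by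
  obtain ⟨K, hK, hK'⟩ := denom_shift_le h.one_lt_r 1
  obtain ⟨U, hU, hU'⟩ := denom_shift_le h.one_lt_r (-1)
  refine ⟨1 / (1 + K + U), by positivity, ?_, fun v => ?_⟩
  · rw [div_le_one (by positivity)]; linarith
  have h1 := hK' (v.shift (-1))
  rw [shift_shift, neg_add_cancel, shift_zero] at h1
  have h2 := hU' v
  have p1 := denom_pos (r := r) v
  have p2 := denom_pos (r := r) (v.shift (-1))
  rw [h.ratio_eq, one_div_one_div]
  refine ⟨(div_le_div_iff₀ (by positivity) p2).2 ?_, (div_le_iff₀ p2).2 ?_⟩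
  · nlinarith [mul_pos hK p1]
  · nlinarith [mul_pos hU p2]

theorem tendsto_cellDeriv (g : N4) (v : LexZ3) {e : ℕ → ℤ} (he : Function.Injective e) :
    Tendsto (fun n => cellDeriv S g (S.left (v.shift (e n)))) atTop (𝓝 1) := by
  have h1 : Tendsto (fun n => e n + -1) atTop cofinite := by
    rw [← Nat.cofinite_eq_atTop]
    exact ((add_left_injective (-1)).comp he).tendsto_cofinite
  refine ((tendsto_denom_div h.one_lt_r h.inv_r g v).comp h1).congr fun n => ?_
  rw [cellDeriv_left, h.len_div, shift_shift]
  rfl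

theorem exists_cellwiseHolder (g : N4) {α : ℝ} (h0 : 0 < α) (h1 : α < 1 / 2)
    (h2 : α * (r - 1) < r / 8) :
    ∃ (b : LexZ3 → ℝ) (K : ℝ), CellwiseHolder S.left (cellDeriv S g) b α K := by
  obtain ⟨κ, hκ0, hκ1, hκ⟩ := h.exists_ratio_bound
  obtain ⟨C, hC, hC'⟩ := denom_cross_sub h.lt_r.le h.r_le g
  obtain ⟨T, hT, hT'⟩ := denom_act_le h.one_lt_r h.inv_r g⁻¹
  have hr := h.r_pos
  have hα' : 0 < 1 - α := by linarith
  -- Convergence of the series of `b ^ (1 / (1 - α))` along a line; clearing denominators, this is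
  -- exactly `α * (r - 1) < r / 8`.
  have hrt : 1 < r * ((1 / 8 + 1 / r - α) * (1 / (1 - α))) := by
    rw [← mul_assoc, mul_one_div, lt_div_iff₀ hα']
    have : r * (1 / 8 + 1 / r - α) = r / 8 + 1 - r * α := by field_simp
    linarith
  obtain ⟨K, hK⟩ := summable_line hr hrt
  set B := 4 / κ ^ 11 * T * C * L ^ α with hB
  have hL := h.L_pos
  have hB0 : 0 ≤ B := by positivity
  have hX : ∀ v, 0 < denom r v := denom_pos
  refine ⟨fun v => B * denom r v ^ (-(1 / 8 + 1 / r - α)), B ^ (1 / (1 - α)) * K, ?_⟩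
  refine ⟨S.strictMono, h0, by linarith, fun x hx => cellDeriv_of_forall_notMem g hx,
    fun v => mul_nonneg hB0 (Real.rpow_nonneg (hX v).le _), fun v x hx y hy => ?_,
    fun v n => ?_, fun v => h.tendsto_cellDeriv g v Nat.cast_injective,
    fun v => h.tendsto_cellDeriv g v (neg_injective.comp Nat.cast_injective)⟩
  · have hlen : |x - y| ≤ (S.pair v).len := by
      rw [ContigPair.len, S.pair_b, S.pair_c, abs_le]
      constructor <;> linarith [hx.1, hx.2, hy.1, hy.2]
    rw [← S.pair_main] at hx hy
    rw [cellDeriv_of_mem_main g hx, cellDeriv_of_mem_main g hy]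
    refine (PixtonTsuboi.abs_dmap_sub_le hκ0 hκ1 (hκ v).1 (hκ v).2 (hκ _).1 (hκ _).2 hx hy).trans
      ?_
    have i1 : (S.pair (act g v)).len / (S.pair v).len ≤ T := by
      rw [h.len_div, div_le_iff₀ (hX _)]
      have := hT' (act g v)
      rwa [← act_mul, inv_mul_cancel, act_one] at this
    have i2 : |(S.pair (act g v)).ratio - (S.pair v).ratio|
        ≤ C * denom r v ^ (-(1 / 8 + 1 / r)) := by
      rw [h.ratio_eq, h.ratio_eq]
      exact hC' v
    have hl := (S.pair v).len_pos
    have hl' := (S.pair (act g v)).len_pos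
    -- A number in `[0,1]` is at most its `α`-th power; replacing the length by `1 / (denom * L)`
    -- then costs the factor `denom ^ α`.
    have i3 : |x - y| / (S.pair v).len ≤ |x - y| ^ α * (denom r v ^ α * L ^ α) := by
      have h01 : |x - y| / (S.pair v).len ≤ 1 := (div_le_one hl).2 hlen
      have h00 : 0 ≤ |x - y| / (S.pair v).len := by positivity
      have : |x - y| / (S.pair v).len ≤ (|x - y| / (S.pair v).len) ^ α := by
        rcases h00.eq_or_lt with h00 | h00
        · rw [← h00, Real.zero_rpow h0.ne']
        · simpa using Real.rpow_le_rpow_of_exponent_ge h00 h01 (by linarith : α ≤ 1)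
      refine this.trans_eq ?_
      rw [h.len_eq, div_div_eq_mul_div, div_one, Real.mul_rpow (abs_nonneg _) (mul_pos (hX v) hL).le,
        Real.mul_rpow (hX v).le hL.le]
    have e : denom r v ^ (-(1 / 8 + 1 / r - α))
        = denom r v ^ (-(1 / 8 + 1 / r)) * denom r v ^ α := by
      rw [← Real.rpow_add (hX v)]; congr 1; ring
    have hX' := hX v
    calc _ ≤ 4 / κ ^ 11 * T * (C * denom r v ^ (-(1 / 8 + 1 / r))) *
          (|x - y| ^ α * (denom r v ^ α * L ^ α)) := by gcongr
      _ = _ := by rw [e, hB]; ring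
  · have e : ∀ k : ℕ, (B * denom r (v.shift k) ^ (-(1 / 8 + 1 / r - α))) ^ (1 / (1 - α)) =
        B ^ (1 / (1 - α)) * denom r (LexZ3.mk v.fstCoord v.sndCoord (v.trdCoord + k)) ^
          (-((1 / 8 + 1 / r - α) * (1 / (1 - α)))) := fun k => by
      rw [Real.mul_rpow hB0 (Real.rpow_nonneg (hX _).le _), ← Real.rpow_mul (hX _).le, neg_mul]
      rfl
    simp only [e]
    rw [← Finset.mul_sum]
    refine mul_le_mul_of_nonneg_left ?_ (Real.rpow_nonneg hB0 _)
    have hinj : Function.Injective fun k : ℕ => v.trdCoord + (k : ℤ) :=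
      (add_right_injective _).comp Nat.cast_injective
    have := hK v.fstCoord v.sndCoord ((Finset.range n).map ⟨_, hinj⟩)
    rwa [Finset.sum_map] at this

end IsWeightedFamily
end

noncomputable section

/-! ### The diffeomorphisms and the embedding -/

open Set Filter Topology MeasureTheory

theorem IsC1Holder.mono {α β : ℝ} (hαβ : α ≤ β) {f : unitInterval → unitInterval}
    (hf : IsC1Holder β f) : IsC1Holder α f := by
  obtain ⟨h1, C, hC⟩ := hf
  refine ⟨h1, |C|, fun x hx y hy => ?_⟩
  rcases eq_or_ne x y with rfl | hxy
  · rw [sub_self, abs_zero]; positivity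
  refine (hC x hx y hy).trans ?_
  have hle : |x - y| ≤ 1 := by
    rw [abs_le]; constructor <;> linarith [hx.1, hx.2, hy.1, hy.2]
  exact mul_le_mul (le_abs_self C)
    (Real.rpow_le_rpow_of_exponent_ge (abs_pos.2 (sub_ne_zero.2 hxy)) hle hαβ)
    (Real.rpow_nonneg (abs_nonneg _) _) (abs_nonneg _)

/-- The primitive of `cellDeriv S g` vanishing at `0`. -/
def cellMap (S : LexIntervals) (g : N4) (x : ℝ) : ℝ := ∫ t in (0 : ℝ)..x, cellDeriv S g t

theorem cellMap_zero (S : LexIntervals) (g : N4) : cellMap S g 0 = 0 :=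
  intervalIntegral.integral_same

theorem LexIntervals.eqOn_of_eqOn_main (S : LexIntervals) {f₁ f₂ : ℝ → ℝ} (h1 : Continuous f₁)
    (h2 : Continuous f₂) (heq : ∀ v, EqOn f₁ f₂ (S.pair v).main) : EqOn f₁ f₂ (Icc 0 1) := by
  have hU : EqOn f₁ f₂ (⋃ v, Ioo (S.left v) (S.left (v.shift 1))) := by
    intro x hx
    obtain ⟨v, hv⟩ := mem_iUnion.1 hx
    refine heq v ?_
    rw [S.pair_main]
    exact Ioo_subset_Icc_self hv
  exact fun x hx => hU.closure h1 h2 (S.dense hx)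

/-- All the derivatives `cellDeriv S g` are `α`-Hölder. -/
structure IsHolderFamily (S : LexIntervals) (r L α : ℝ) : Prop extends
    IsWeightedFamily S r L where
  pos : 0 < α
  holder : ∀ g, ∃ C, ∀ x y, |cellDeriv S g x - cellDeriv S g y| ≤ C * |x - y| ^ α

theorem IsWeightedFamily.isHolderFamily {S : LexIntervals} {r L α : ℝ}
    (h : IsWeightedFamily S r L) (h0 : 0 < α) (h1 : α < 1 / 2) (h2 : α * (r - 1) < r / 8) :
    IsHolderFamily S r L α :=
  { h with
    pos := h0
    holder := fun g => by
      obtain ⟨b, K, hK⟩ := h.exists_cellwiseHolder g h0 h1 h2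
      exact ⟨_, hK.holder⟩ }

namespace IsHolderFamily

variable {S : LexIntervals} {r L α : ℝ} (h : IsHolderFamily S r L α) (g : N4) {v : LexZ3} {x : ℝ}

include h

theorem continuous_cellDeriv : Continuous (cellDeriv S g) := by
  obtain ⟨C, hC⟩ := h.holder g
  exact continuous_of_abs_sub_le h.pos hC

theorem hasDerivAt_cellMap (x : ℝ) : HasDerivAt (cellMap S g) (cellDeriv S g x) x :=
  intervalIntegral.integral_hasDerivAt_right
    ((h.continuous_cellDeriv g).intervalIntegrable _ _)
    ((h.continuous_cellDeriv g).stronglyMeasurableAtFilter _ _)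
    (h.continuous_cellDeriv g).continuousAt

theorem continuous_cellMap : Continuous (cellMap S g) :=
  continuous_iff_continuousAt.2 fun x => (h.hasDerivAt_cellMap g x).continuousAt

theorem strictMono_cellMap : StrictMono (cellMap S g) :=
  strictMono_of_hasDerivAt_pos (h.hasDerivAt_cellMap g) (cellDeriv_pos g)

theorem contDiff_cellMap : ContDiff ℝ 1 (cellMap S g) := by
  refine contDiff_one_iff_deriv.2 ⟨fun x => (h.hasDerivAt_cellMap g x).differentiableAt, ?_⟩
  rw [funext fun x => (h.hasDerivAt_cellMap g x).deriv]
  exact h.continuous_cellDeriv g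

theorem integral_cellDeriv (hx : x ∈ (S.pair v).main) : ∫ t in S.left v..x, cellDeriv S g t =
    PixtonTsuboi.map (S.pair v) (S.pair (LexZ3.act g v)) x - S.left (LexZ3.act g v) := by
  have hx' := hx
  rw [S.pair_main] at hx'
  rw [intervalIntegral.integral_eq_sub_of_hasDerivAt
    (f := PixtonTsuboi.map (S.pair v) (S.pair (LexZ3.act g v))) (fun t ht => ?_)
    ((h.continuous_cellDeriv g).intervalIntegrable _ _)]
  · rw [← S.pair_b v, PixtonTsuboi.map_b, S.pair_b]
  · rw [uIcc_of_le hx'.1] at ht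
    have ht' : t ∈ (S.pair v).main := by
      rw [S.pair_main]; exact ⟨ht.1, ht.2.trans hx'.2⟩
    rw [cellDeriv_of_mem_main g ht']
    exact PixtonTsuboi.hasDerivAt_map ht'

theorem integral_lexCell (v : LexZ3) : ∫ t in lexCell S.left v, cellDeriv S g t =
    lexWeight 8 8 r (LexZ3.act g v) / L := by
  have hle : S.left v ≤ S.left (v.shift 1) := by
    rw [h.cumulative.left_shift_one]; linarith [h.cumulative.pos v]
  have h1 := h.integral_cellDeriv g (v := v) (x := S.left (v.shift 1))
    (by rw [S.pair_main]; exact right_mem_Icc.2 hle)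
  rw [lexCell, integral_Ico_eq_integral_Ioc, ← intervalIntegral.integral_of_le hle, h1,
    ← S.pair_c v, PixtonTsuboi.map_c, S.pair_c, h.cumulative.left_shift_one, add_sub_cancel_left]

/-- The cells of `A` fill `[0, t)` up to a null set, so the integral of the derivative is the sum of
the lengths of the image intervals. -/
theorem cellMap_eq_of_hasSum {A : Set LexZ3} {t t' : ℝ} (ht : 0 ≤ t)
    (hA : HasSum (A.indicator fun v => lexWeight 8 8 r v / L) t)
    (hsub : ∀ u ∈ A, lexCell S.left u ⊆ Ico 0 t)
    (hA' : HasSum (A.indicator fun v => lexWeight 8 8 r (LexZ3.act g v) / L) t') :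
    cellMap S g t = t' := by
  have hae := h.cumulative.iUnion_lexCell_ae_eq hA hsub
  have hint : IntegrableOn (cellDeriv S g) (⋃ u : A, lexCell S.left u) :=
    ((h.continuous_cellDeriv g).integrableOn_Icc (a := 0) (b := t)).mono_set
      (iUnion_subset fun u => (hsub u u.2).trans Ico_subset_Icc_self)
  have hs := hasSum_integral_iUnion (f := cellDeriv S g) (μ := volume)
    (s := fun u : A => lexCell S.left u)
    (fun u => measurableSet_Ico)
    (fun u v huv => lexCell_disjoint S.strictMono (fun e => huv (Subtype.ext e))) hint
  simp only [h.integral_lexCell] at hs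
  rw [setIntegral_congr_set hae, integral_Ico_eq_integral_Ioc,
    ← intervalIntegral.integral_of_le ht] at hs
  exact hs.unique (hasSum_subtype_iff_indicator.2 hA')

theorem cellMap_left (v : LexZ3) : cellMap S g (S.left v) = S.left (LexZ3.act g v) := by
  refine h.cellMap_eq_of_hasSum g (S.mem v).1 (h.cumulative.hasSum_left v) (fun u hu x hx => ?_) ?_
  · exact ⟨(S.mem u).1.trans hx.1,
      hx.2.trans_le (h.cumulative.monotone (LexZ3.shift_one_le hu))⟩
  · have := h.cumulative.hasSum_left (LexZ3.act g v)
    -- As `g` preserves the order, it maps `Iio v` onto `Iio (g v)`, and the sum defining the image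
    -- endpoint is reindexed by it.
    rw [← (latticeAction g).toEquiv.hasSum_iff] at this
    convert this using 1
    ext u
    have hiff : LexZ3.act g u ∈ Iio (LexZ3.act g v) ↔ u ∈ Iio v :=
      (LexZ3.act_strictMono g).lt_iff_lt
    change _ = (Iio (LexZ3.act g v)).indicator _ (LexZ3.act g u)
    by_cases hu : u ∈ Iio v
    · rw [indicator_of_mem hu, indicator_of_mem (hiff.2 hu)]
    · rw [indicator_of_notMem hu, indicator_of_notMem (mt hiff.1 hu)]

theorem cellMap_one : cellMap S g 1 = 1 := by
  refine h.cellMap_eq_of_hasSum (A := univ) g zero_le_one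
    (by simpa using h.cumulative.hasSum_one)
    (fun u _ => h.cumulative.lexCell_subset_Ico_one u) ?_
  have := h.cumulative.hasSum_one
  rw [← (latticeAction g).toEquiv.hasSum_iff] at this
  rw [indicator_univ]
  exact this

theorem cellMap_mem (hx : x ∈ Icc (0 : ℝ) 1) : cellMap S g x ∈ Icc (0 : ℝ) 1 := by
  have h0 := (h.strictMono_cellMap g).monotone hx.1
  have h1 := (h.strictMono_cellMap g).monotone hx.2
  rw [cellMap_zero] at h0
  rw [h.cellMap_one] at h1
  exact ⟨h0, h1⟩

theorem cellMap_eq_map (hx : x ∈ (S.pair v).main) : cellMap S g x =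
    PixtonTsuboi.map (S.pair v) (S.pair (LexZ3.act g v)) x := by
  have hi : ∀ a b : ℝ, IntervalIntegrable (cellDeriv S g) volume a b := fun a b =>
    (h.continuous_cellDeriv g).intervalIntegrable _ _
  have h1 := intervalIntegral.integral_add_adjacent_intervals (hi 0 (S.left v)) (hi (S.left v) x)
  have h2 := h.cellMap_left g v
  rw [cellMap] at h2
  rw [h.integral_cellDeriv g hx, h2, add_sub_cancel] at h1
  exact h1.symm

/-- On each interval this is the equivariance of the Pixton–Tsuboi maps; density and continuity
extend it to `[0,1]`. -/
theorem cellMap_comp (g₁ g₂ : N4) (hx : x ∈ Icc (0 : ℝ) 1) :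
    cellMap S g₁ (cellMap S g₂ x) = cellMap S (g₁ * g₂) x := by
  refine S.eqOn_of_eqOn_main ((h.continuous_cellMap g₁).comp (h.continuous_cellMap g₂))
    (h.continuous_cellMap (g₁ * g₂)) (fun v y hy => ?_) hx
  rw [Function.comp_apply, h.cellMap_eq_map g₂ hy,
    h.cellMap_eq_map g₁ (PixtonTsuboi.map_mapsTo hy), PixtonTsuboi.map_comp _ hy,
    h.cellMap_eq_map _ hy, LexZ3.act_mul]

theorem cellMap_id (hx : x ∈ Icc (0 : ℝ) 1) : cellMap S 1 x = x := by
  refine S.eqOn_of_eqOn_main (h.continuous_cellMap 1) continuous_id (fun v y hy => ?_) hx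
  rw [h.cellMap_eq_map 1 hy, LexZ3.act_one, PixtonTsuboi.map_self hy, id]

/-- The homeomorphism of `[0,1]` given by `cellMap S g`. -/
def homeo : unitInterval ≃ₜ unitInterval where
  toFun x := ⟨cellMap S g x, h.cellMap_mem g x.2⟩
  invFun x := ⟨cellMap S g⁻¹ x, h.cellMap_mem g⁻¹ x.2⟩
  left_inv x := Subtype.ext (by
    change cellMap S g⁻¹ (cellMap S g x) = x
    rw [h.cellMap_comp _ _ x.2, inv_mul_cancel, h.cellMap_id x.2])
  right_inv x := Subtype.ext (by
    change cellMap S g (cellMap S g⁻¹ x) = x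
    rw [h.cellMap_comp _ _ x.2, mul_inv_cancel, h.cellMap_id x.2])
  continuous_toFun := ((h.continuous_cellMap g).comp continuous_subtype_val).subtype_mk _
  continuous_invFun := ((h.continuous_cellMap g⁻¹).comp continuous_subtype_val).subtype_mk _

theorem coe_homeo_apply (x : unitInterval) : (h.homeo g x : ℝ) = cellMap S g x := rfl

theorem isC1Holder_homeo : IsC1Holder α (h.homeo g) := by
  have heq : EqOn (unitExtend (h.homeo g)) (cellMap S g) (Icc 0 1) := fun x hx => by
    simp [unitExtend, IccExtend_of_mem _ _ hx, h.coe_homeo_apply]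
  obtain ⟨C, hC⟩ := h.holder g
  refine ⟨(h.contDiff_cellMap g).contDiffOn.congr heq, C, fun x hx y hy => ?_⟩
  have hd : ∀ z ∈ Icc (0 : ℝ) 1,
      derivWithin (unitExtend (h.homeo g)) (Icc 0 1) z = cellDeriv S g z := fun z hz => by
    rw [derivWithin_congr heq (heq hz)]
    exact (h.hasDerivAt_cellMap g z).hasDerivWithinAt.derivWithin
      (uniqueDiffOn_Icc zero_lt_one z hz)
  rw [hd x hx, hd y hy]
  exact hC x y

theorem homeo_symm : (h.homeo g).symm = h.homeo g⁻¹ := by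
  ext x; rfl

/-- The representation of `N4` by diffeomorphisms. -/
def rep {β : ℝ} (hβ : β ≤ α) : N4 →* DiffPlus β :=
  MonoidHom.mk' (fun g => ⟨h.homeo g, fun _ _ hxy => h.strictMono_cellMap g hxy,
    (h.isC1Holder_homeo g).mono hβ, by
      rw [h.homeo_symm]; exact (h.isC1Holder_homeo g⁻¹).mono hβ⟩)
    fun g₁ g₂ => Subtype.ext (Homeomorph.ext fun x => Subtype.ext
      (h.cellMap_comp g₁ g₂ x.2).symm)

theorem coe_rep_apply {β : ℝ} (hβ : β ≤ α) (x : unitInterval) :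
    (((h.rep hβ g : unitInterval ≃ₜ unitInterval) x : unitInterval) : ℝ) = cellMap S g x := rfl

theorem rep_injective {β : ℝ} (hβ : β ≤ α) : Function.Injective (h.rep hβ) := by
  refine (injective_iff_map_eq_one _).2 fun g hg => LexZ3.act_injective fun v => ?_
  refine S.strictMono.injective ?_
  have h1 := h.coe_rep_apply g hβ ⟨S.left v, S.mem v⟩
  rw [hg, h.cellMap_left] at h1
  exact h1.symm

end IsHolderFamily

/-! ### Choice of the exponents -/

theorem exists_exponent {a : ℝ} (h0 : 1 / 4 ≤ a) (h1 : a < 1 / 2) :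
    ∃ r : ℝ, 4 / 3 < r ∧ r ≤ 3 / 2 ∧ a * (r - 1) < r / 8 := by
  have hpos : 0 < a - 1 / 8 := by linarith
  -- The required inequality reads `r < a / (a - 1/8)`, and this bound exceeds `4 / 3` exactly when
  -- `a < 1 / 2`.
  have hlt : 4 / 3 < a / (a - 1 / 8) := by rw [lt_div_iff₀ hpos]; linarith
  obtain ⟨r, hr1, hr2⟩ := exists_between (lt_min hlt (by norm_num : (4 / 3 : ℝ) < 3 / 2))
  refine ⟨r, hr1, (hr2.trans_le (min_le_right _ _)).le, ?_⟩
  have := hr2.trans_le (min_le_left _ _)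
  rw [lt_div_iff₀ hpos] at this
  linarith

/-- The value `8` is the least `p` with `4 ≤ p (1 - α)` for every `α < 1/2`; with `p = q = 8` the
summability condition becomes `r > 4/3`. -/
theorem admissibleExponents {α a r : ℝ} (hαa : α ≤ a) (h1 : a < 1 / 2)
    (hr : 4 / 3 < r) (hr' : r ≤ 3 / 2) (har : a * (r - 1) < r / 8) :
    AdmissibleExponents α 8 8 r := by
  have hr0 : 0 < r := by linarith
  have i1 : 1 / r < 3 / 4 := by rw [div_lt_div_iff₀ hr0 (by norm_num)]; linarith
  have i2 : 2 / 3 ≤ 1 / r := by rw [div_le_div_iff₀ (by norm_num) hr0]; linarith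
  have i3 : α ≤ r / (8 * (r - 1)) := by
    rw [le_div_iff₀ (by linarith)]
    nlinarith
  refine ⟨by norm_num, by norm_num, hr0, ?_, ?_, ?_, ?_, ?_, ?_, ⟨?_, i3⟩, ⟨?_, i3⟩⟩ <;> linarith

end

theorem theoremA (α : ℝ) (hα : α < 1 / 2) :
    ∃ ρ : N4 →* DiffPlus α, Function.Injective ρ ∧
      ∃ p q r : ℝ, AdmissibleExponents α p q r ∧
      ∃ (S : LexIntervals) (φ : ContigPair → ContigPair → ℝ → ℝ),
        S.HasLengths p q r ∧ IsPixtonTsuboi φ ∧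
        ∀ (g : N4) (v : LexZ3) (x : unitInterval), (x : ℝ) ∈ (S.pair v).main →
          (((ρ g : unitInterval ≃ₜ unitInterval) x : unitInterval) : ℝ)
            = φ (S.pair v) (S.pair (latticeAction g v)) (x : ℝ) := by
  -- The construction needs a positive Hölder exponent, so it is carried out for `max α (1/4)`;
  -- higher regularity implies the one asked for.
  have ha0 : 1 / 4 ≤ max α (1 / 4) := le_max_right _ _
  have ha1 : max α (1 / 4) < 1 / 2 := max_lt hα (by norm_num)
  obtain ⟨r, hr, hr', har⟩ := exists_exponent ha0 ha1
  have hsum := LexZ3.summable_lexWeight hr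
  have hw : ∀ v, 0 < lexWeight 8 8 r v := fun v => one_div_pos.2 (LexZ3.denom_pos v)
  have hL : 0 < ∑' v, lexWeight 8 8 r v :=
    hsum.tsum_pos (fun v => (hw v).le) (LexZ3.mk 0 0 0) (hw _)
  have hcum := exists_isCumulative (ℓ := fun v => lexWeight 8 8 r v / ∑' w, lexWeight 8 8 r w)
    (fun v => div_pos (hw v) hL) (by
      have := hsum.hasSum.div_const (∑' w, lexWeight 8 8 r w)
      rwa [div_self hL.ne'] at this)
  have hfam : IsWeightedFamily hcum.toLexIntervals r (∑' w, lexWeight 8 8 r w) :=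
    ⟨hr, hr', hL, hcum⟩
  have hH := hfam.isHolderFamily (by linarith) ha1 har
  refine ⟨hH.rep (le_max_left _ _), hH.rep_injective _, 8, 8, r,
    admissibleExponents (le_max_left _ _) ha1 hr hr' har, hcum.toLexIntervals, PixtonTsuboi.map,
    ⟨hsum, fun v => ?_⟩, PixtonTsuboi.isPixtonTsuboi_map, fun g v x hx => ?_⟩
  · rw [hfam.len_eq, LexZ3.lexWeight_eq, div_div]
  · rw [hH.coe_rep_apply, hH.cellMap_eq_map g hx]
    rfl
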